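/- Conventions. An $\ell$-graph is a finite $\ell$-uniform hypergraph $G=(V,E)$, with $v(G)=|V|$ and $e(G)=|E|$; subgraphs need not be induced. For $v(G)\ge \ell+1$ let $d_\ell(G)=\frac{e(G)-1}{v(G)-\ell}$ and $m_\ell(G)=\max\{d_\ell(J): J\subseteq G,\ v(J)\ge \ell+1\}$. An $\ell$-graph $G$ with $v(G)\ge\ell+1$ is strictly $\ell$-balanced if $m_\ell(G)=d_\ell(G)$ and $d_\ell(J)<m_\ell(G)$ for every proper subgraph $J\subsetneq G$ with $v(J)\ge \ell+1$. For an $\ell$-graph $F$ with at least two edges let $\gamma(F)=\max\{|e_1\cap e_2| : e_1,e_2\in E(F),\ e_1\ne e_2\}$. An $F$-copy in $G$ is a subgraph of $G$ isomorphic to $F$. Edges $e_1,e_2\in E(G)$ are $F$-equivalent in $G$ if every $F$-copy in $G$ contains either both or neither of them. An edge $e\in E(G)$ is $F$-closed if either $\gamma(F)=\ell-1$ and $e$ belongs to at least two $F$-copies in $G$, or $\gamma(F)<\ell-1$, $e$ belongs to at least two $F$-copies in $G$, and no edge $e'\in E(G)\setminus\{e\}$ is $F$-equivalent to $e$. An $F$-copy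 in $G$ is $F$-closed if at least three of its edges are $F$-closed. The $\ell$-graph $G$ is $F$-closed if every vertex and every edge of $G$ belongs to at least one $F$-copy in $G$ and every $F$-copy in $G$ is $F$-closed. An $F$-block is an $F$-closed $\ell$-graph $B$ such that for every non-empty proper subset $E'\subsetneq E(B)$ some $F$-copy $F'$ in $B$ satisfies $E(F')\cap E'\neq\emptyset$ and $E(F')\setminus E'\ne\emptyset$ (all notions being taken with respect to $B$). Finally, $G^{(\ell)}(n,p)$ is the random $\ell$-graph on $n$ vertices in which every $\ell$-subset of the vertices is an edge with probability $p$, independently. Theorem 2.5. Let $\ell\ge 2$ be an integer and let $F$ be a strictly $\ell$-balanced $\ell$-graph such that either $F$ has exactly three edges and $\gamma(F)=\ell-1$, or $F$ has at least four edges. Then there exist constants $c,L>0$ (depending only on $F$) such that for every sequence $p=p(n)\in[0,1]$ with $p(n)\le c\,n^{-1/m_\ell(F)}$ for all sufficiently large $n$, $$\lim_{n\to\infty}\Pr\bigl[\text{every } F\text{-block } B\subseteq G^{(\ell)}(n,p(n)) \text{ has at most } L \text{ vertices}\bigr]=1 .$$ -/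

import Mathlib

open Filter Topology

/-- A (finite) `ℓ`-uniform hypergraph, or `ℓ`-graph, with vertices taken from the type `V`:
a finite vertex set and a finite set of edges, each edge being an `ℓ`-subset of the vertex set. -/
@[ext]
structure LGraph (ℓ : ℕ) (V : Type*) where
  verts : Finset V
  edges : Finset (Finset V)
  edge_subset : ∀ e ∈ edges, e ⊆ verts
  edge_card : ∀ e ∈ edges, e.card = ℓ

namespace LGraph

/-- `J ⊆ G`: `J` is a (not necessarily induced) subgraph of `G`. -/
def IsSubgraph {ℓ : ℕ} {V : Type*} (J G : LGraph ℓ V) : Prop :=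
  J.verts ⊆ G.verts ∧ J.edges ⊆ G.edges

/-- `F ≅ G`: there is a bijection between the vertex sets under which edges correspond to edges
and non-edges to non-edges. -/
def IsIsomorphic {ℓ : ℕ} {W V : Type*} (F : LGraph ℓ W) (G : LGraph ℓ V) : Prop :=
  ∃ f : {x // x ∈ F.verts} ≃ {y // y ∈ G.verts}, ∀ s : Finset {x // x ∈ F.verts},
    s.map (Function.Embedding.subtype _) ∈ F.edges ↔
      (s.map f.toEmbedding).map (Function.Embedding.subtype _) ∈ G.edges

/-- `F'` is an `F`-copy in `G`: a subgraph of `G` that is isomorphic to `F`. -/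
def IsCopyIn {ℓ : ℕ} {W V : Type*} (F : LGraph ℓ W) (F' G : LGraph ℓ V) : Prop :=
  F'.IsSubgraph G ∧ F.IsIsomorphic F'

/-- The `ℓ`-density `d_ℓ(G) = (e(G) - 1) / (v(G) - ℓ)`, meant for `v(G) ≥ ℓ + 1`. -/
noncomputable def density {ℓ : ℕ} {V : Type*} (G : LGraph ℓ V) : ℝ :=
  ((G.edges.card : ℝ) - 1) / ((G.verts.card : ℝ) - (ℓ : ℝ))

/-- The set of the `ℓ`-densities of all subgraphs of `G` on at least `ℓ + 1` vertices. -/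
def subgraphDensities {ℓ : ℕ} {V : Type*} (G : LGraph ℓ V) : Set ℝ :=
  {x : ℝ | ∃ J : LGraph ℓ V, J.IsSubgraph G ∧ ℓ + 1 ≤ J.verts.card ∧ x = J.density}

/-- `m_ℓ(G)`, the maximum `ℓ`-density of a subgraph of `G` on at least `ℓ + 1` vertices. -/
noncomputable def maxDensity {ℓ : ℕ} {V : Type*} (G : LGraph ℓ V) : ℝ :=
  sSup G.subgraphDensities

/-- If `v(G) ≥ ℓ + 1` then the supremum defining `m_ℓ(G)` is a maximum. -/
theorem isGreatest_maxDensity {ℓ : ℕ} {V : Type*} (G : LGraph ℓ V)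
    (h : ℓ + 1 ≤ G.verts.card) : IsGreatest G.subgraphDensities G.maxDensity := by
  have hfin : G.subgraphDensities.Finite := by
    refine Set.Finite.subset (((G.verts.powerset ×ˢ G.edges.powerset).finite_toSet).image
      (fun q => ((q.2.card : ℝ) - 1) / ((q.1.card : ℝ) - (ℓ : ℝ)))) ?_
    rintro x ⟨J, hJ, -, rfl⟩
    exact ⟨(J.verts, J.edges), by simpa [IsSubgraph] using hJ, rfl⟩
  have hne : G.subgraphDensities.Nonempty :=
    ⟨_, G, ⟨Finset.Subset.refl _, Finset.Subset.refl _⟩, h, rfl⟩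
  exact ⟨hne.csSup_mem hfin, fun x hx => le_csSup hfin.bddAbove hx⟩

/-- `G` (on at least `ℓ + 1` vertices) is strictly `ℓ`-balanced: `m_ℓ(G) = d_ℓ(G)`, and
`d_ℓ(J) < m_ℓ(G)` for every proper subgraph `J` of `G` on at least `ℓ + 1` vertices. -/
def IsStrictlyBalanced {ℓ : ℕ} {V : Type*} (G : LGraph ℓ V) : Prop :=
  ℓ + 1 ≤ G.verts.card ∧ G.maxDensity = G.density ∧
    ∀ J : LGraph ℓ V, J.IsSubgraph G → J ≠ G → ℓ + 1 ≤ J.verts.card → J.density < G.maxDensity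

open Classical in
/-- `γ(F)`, the largest intersection of two distinct edges of `F` (for `F` with at least two
edges). -/
noncomputable def gamma {ℓ : ℕ} {W : Type*} (F : LGraph ℓ W) : ℕ :=
  F.edges.offDiag.sup fun q => (q.1 ∩ q.2).card

/-- `e₁ ≡_F e₂` in `G`: every `F`-copy in `G` contains either both or none of `e₁`, `e₂`. -/
def FEquivalent {ℓ : ℕ} {W V : Type*} (F : LGraph ℓ W) (G : LGraph ℓ V) (e₁ e₂ : Finset V) :
    Prop :=
  ∀ F' : LGraph ℓ V, F.IsCopyIn F' G → (e₁ ∈ F'.edges ↔ e₂ ∈ F'.edges)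

/-- The edge `e` belongs to at least two `F`-copies in `G`. -/
def InTwoCopies {ℓ : ℕ} {W V : Type*} (F : LGraph ℓ W) (G : LGraph ℓ V) (e : Finset V) : Prop :=
  ∃ F₁ F₂ : LGraph ℓ V, F₁ ≠ F₂ ∧ F.IsCopyIn F₁ G ∧ F.IsCopyIn F₂ G ∧
    e ∈ F₁.edges ∧ e ∈ F₂.edges

/-- The edge `e` of `G` is `F`-closed. The conditions `γ(F) = ℓ - 1` and `γ(F) < ℓ - 1` are
written without subtraction. -/
def EdgeClosed {ℓ : ℕ} {W V : Type*} (F : LGraph ℓ W) (G : LGraph ℓ V) (e : Finset V) : Prop :=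
  e ∈ G.edges ∧
    ((F.gamma + 1 = ℓ ∧ F.InTwoCopies G e) ∨
      (F.gamma + 1 < ℓ ∧ F.InTwoCopies G e ∧
        ∀ e' ∈ G.edges, e' ≠ e → ¬ F.FEquivalent G e e'))

/-- The `F`-copy `F'` in `G` is `F`-closed: at least three of its edges are `F`-closed in `G`. -/
def CopyClosed {ℓ : ℕ} {W V : Type*} (F : LGraph ℓ W) (G F' : LGraph ℓ V) : Prop :=
  ∃ T : Finset (Finset V), T ⊆ F'.edges ∧ 3 ≤ T.card ∧ ∀ e ∈ T, F.EdgeClosed G e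

/-- `G` is `F`-closed: every vertex and every edge of `G` belongs to an `F`-copy in `G`, and every
`F`-copy in `G` is `F`-closed. -/
def FClosed {ℓ : ℕ} {W V : Type*} (F : LGraph ℓ W) (G : LGraph ℓ V) : Prop :=
  (∀ v ∈ G.verts, ∃ F' : LGraph ℓ V, F.IsCopyIn F' G ∧ v ∈ F'.verts) ∧
  (∀ e ∈ G.edges, ∃ F' : LGraph ℓ V, F.IsCopyIn F' G ∧ e ∈ F'.edges) ∧
  (∀ F' : LGraph ℓ V, F.IsCopyIn F' G → F.CopyClosed G F')

/-- `G` is an `F`-block: it is `F`-closed, and for every non-empty proper subset `E'` of its edges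
some `F`-copy in `G` has an edge in `E'` and an edge outside `E'`. -/
def IsBlock {ℓ : ℕ} {W V : Type*} (F : LGraph ℓ W) (G : LGraph ℓ V) : Prop :=
  F.FClosed G ∧
  ∀ E' : Finset (Finset V), E' ⊂ G.edges → E'.Nonempty →
    ∃ F' : LGraph ℓ V, F.IsCopyIn F' G ∧
      (∃ e ∈ F'.edges, e ∈ E') ∧ (∃ e ∈ F'.edges, e ∉ E')

open Classical in
/-- The `ℓ`-graph on the vertex set `{0, …, n - 1}` whose edges are the `ℓ`-sets in `E`. -/
noncomputable def ofEdges (ℓ n : ℕ) (E : Set (Finset (Fin n))) : LGraph ℓ (Fin n) where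
  verts := Finset.univ
  edges := (Finset.powersetCard ℓ Finset.univ).filter (fun e => e ∈ E)
  edge_subset := fun _ _ => Finset.subset_univ _
  edge_card := fun _ he => (Finset.mem_powersetCard.mp (Finset.mem_filter.mp he).1).2

/-- The probability that the binomial random `ℓ`-graph `G^(ℓ)(n, p)` has the property `P`: every
`ℓ`-subset of the `n` vertices is an edge with probability `p`, independently of the others. -/
noncomputable def binomialProb (ℓ n : ℕ) (p : unitInterval) (P : LGraph ℓ (Fin n) → Prop) : ℝ :=
  (ProbabilityTheory.setBernoulli {e : Finset (Fin n) | e.card = ℓ} p).real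
    {E : Set (Finset (Fin n)) | P (ofEdges ℓ n E)}

end LGraph

/-!
Write `v(F) = ℓ + R` and `e(F) = M + 1`, so that `m_ℓ(F) = M / R` and, with `z = n ^ (1 / (4M))`,
the hypothesis on `p` reads `p * z ^ (4R) ≤ c` while `n = z ^ (4M)`.

A block `B` is explored copy by copy. A *history* is a list of copies of `F`, the latest first; its
*hull* is the union of its members. As long as some member is not closed in the hull, the next copy
has to share an edge with the oldest such member; otherwise it only has to share an edge with the
hull. In both cases it must bring a new edge. Inside a block a history can be continued until its
hull is the whole block (`IsBlock.exists_extension`).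

A step is *regular* if the new copy meets the hull in a single edge only, and *degenerate*
otherwise. By strict balancedness, a degenerate step has expected number at most a negative power
of `n` (up to a power of the length of the history), whereas a regular step attached to a given
member has expected number `O(c)`. Regular steps attached to an arbitrary edge of the hull only
happen at the start or after a degenerate step (`IsHistory.freeCount_le`). Giving each step a
compensating factor yields a weight whose total over all histories of a given length does not
increase with the length (`sum_step_le`, `sum_weight_le`). Histories that have length `N`, of order
`log n`, or that have many degenerate steps, have large weight, so asymptotically almost surely
none of them lies in the random hypergraph (`sum_badHistories_le`).

What remains is deterministic: a history whose hull is a block and which has few degenerate steps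
is short. Call a member *pendant* if the other members meet it within one of its edges. The *cut
lemma* `IsTight.cut` describes all copies of `F` in a graph that has such a pendant part; it shows
that a pendant member is not closed (`not_copyClosed_of_pendant`), and neither is one that was
pendant until a single regular step attached a copy to it (`not_copyClosed_of_touched`). Since the
exploration serves the oldest unclosed member, every two consecutive regular steps gain a pendant
member, while a degenerate step destroys at most `v(F)` of them. This is expressed by a potential
(`potential_add_one_le`, `potential_le_add`) which is zero when all members are closed; hence the
number of regular steps is bounded by the number of degenerate ones (`IsHistory.regCount_le`).
-/

namespace LGraph

/-! ### Strictly balanced graphs in numerical form -/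

section Tight

variable {ℓ : ℕ} {V W : Type*} {C : LGraph ℓ V} {R M : ℕ}

/-- `C` has `ℓ + R` vertices, `M + 1` edges and is strictly `ℓ`-balanced. The last condition is
`(e(J) - 1) / (v(J) - ℓ) < M / R` for the proper subgraphs `J = (U, E)` with `v(J) > ℓ`, with
denominators cleared and without subtraction. -/
structure IsTight (C : LGraph ℓ V) (R M : ℕ) : Prop where
  card_verts : C.verts.card = ℓ + R
  card_edges : C.edges.card = M + 1
  strict : ∀ (U : Finset V) (E : Finset (Finset V)), U ⊆ C.verts → E ⊆ C.edges →
    (∀ f ∈ E, f ⊆ U) → ℓ < U.card → (U ≠ C.verts ∨ E ≠ C.edges) →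
    R * E.card + M * ℓ < M * U.card + R

theorem card_le_one_of_card_eq {U : Finset V} {E : Finset (Finset V)} (hE : E ⊆ C.edges)
    (hEU : ∀ f ∈ E, f ⊆ U) (hU : U.card = ℓ) : E.card ≤ 1 := by
  have h : ∀ f ∈ E, f = U := fun f hf =>
    Finset.eq_of_subset_of_card_le (hEU f hf) (by rw [hU, C.edge_card f (hE hf)])
  exact Finset.card_le_one.2 fun a ha b hb => (h a ha).trans (h b hb).symm

theorem IsTight.le (hC : C.IsTight R M) {U : Finset V} {E : Finset (Finset V)}
    (hU : U ⊆ C.verts) (hE : E ⊆ C.edges) (hEU : ∀ f ∈ E, f ⊆ U) (hc : ℓ ≤ U.card) :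
    R * E.card + M * ℓ ≤ M * U.card + R := by
  rcases hc.eq_or_lt with h | h
  · have h1 := card_le_one_of_card_eq hE hEU h.symm
    rw [← h]
    nlinarith
  · by_cases h2 : U ≠ C.verts ∨ E ≠ C.edges
    · exact (hC.strict U E hU hE hEU h h2).le
    · push Not at h2
      rw [h2.1, h2.2, hC.card_verts, hC.card_edges]
      nlinarith

/-- The inequality of `IsTight.le` is an equality only for the whole graph and for single edges. -/
theorem IsTight.eq_or (hC : C.IsTight R M) (hR : 0 < R) {U : Finset V} {E : Finset (Finset V)}
    (hU : U ⊆ C.verts) (hE : E ⊆ C.edges) (hEU : ∀ f ∈ E, f ⊆ U) (hc : ℓ ≤ U.card)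
    (heq : M * U.card + R ≤ R * E.card + M * ℓ) :
    (U = C.verts ∧ E = C.edges) ∨ (U.card = ℓ ∧ E.card = 1) := by
  rcases hc.eq_or_lt with h | h
  · have h1 := card_le_one_of_card_eq hE hEU h.symm
    right
    refine ⟨h.symm, ?_⟩
    rw [← h] at heq
    by_contra h2
    have h3 : E.card = 0 := by omega
    rw [h3] at heq
    omega
  · by_contra h2
    have := hC.strict U E hU hE hEU h (by tauto)
    omega

/-- A strictly balanced graph has no isolated vertex, so a copy is determined by its edges. -/
theorem IsTight.exists_mem_edge (hC : C.IsTight R M) (hR : 0 < R) (hM : 0 < M) {x : V}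
    (hx : x ∈ C.verts) : ∃ f ∈ C.edges, x ∈ f := by
  classical
  by_contra! h
  have hsub : ∀ f ∈ C.edges, f ⊆ C.verts.erase x := fun f hf =>
    Finset.subset_erase.2 ⟨C.edge_subset f hf, h f hf⟩
  have hcard : (C.verts.erase x).card = ℓ + R - 1 := by
    rw [Finset.card_erase_of_mem hx, hC.card_verts]
  have h1 := hC.le (Finset.erase_subset _ _) subset_rfl hsub (by omega)
  rw [hcard, hC.card_edges] at h1
  obtain ⟨R, rfl⟩ : ∃ k, R = k + 1 := ⟨R - 1, by omega⟩
  have : ℓ + (R + 1) - 1 = ℓ + R := by omega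
  rw [this] at h1
  nlinarith

theorem IsTight.verts_subset_of_edges (hC : C.IsTight R M) (hR : 0 < R) (hM : 0 < M)
    {G : LGraph ℓ V} (h : C.edges ⊆ G.edges) : C.verts ⊆ G.verts := fun x hx => by
  obtain ⟨f, hf, hxf⟩ := hC.exists_mem_edge hR hM hx
  exact G.edge_subset f (h hf) hxf

theorem IsTight.eq_of_edges_eq {D : LGraph ℓ V} (hC : C.IsTight R M) (hD : D.IsTight R M)
    (hR : 0 < R) (hM : 0 < M) (h : C.edges = D.edges) : C = D :=
  LGraph.ext ((hC.verts_subset_of_edges hR hM h.subset).antisymm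
    (hD.verts_subset_of_edges hR hM h.superset)) h

theorem IsStrictlyBalanced.isTight {F : LGraph ℓ W} (hF : F.IsStrictlyBalanced)
    (hv : F.verts.card = ℓ + R) (he : F.edges.card = M + 1) : F.IsTight R M := by
  have hR : 0 < R := by have := hF.1; omega
  refine ⟨hv, he, fun U E hU hE hEU hUc hne => ?_⟩
  have h := hF.2.2 ⟨U, E, hEU, fun f hf => F.edge_card f (hE hf)⟩ ⟨hU, hE⟩
    (fun h => by
      rcases hne with h' | h'
      · exact h' (congrArg LGraph.verts h)
      · exact h' (congrArg LGraph.edges h)) hUc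
  rw [hF.2.1, density, density, hv, he] at h
  have h1 : (0 : ℝ) < (U.card : ℝ) - ℓ := by
    have : (ℓ : ℝ) < U.card := by exact_mod_cast hUc
    linarith
  have h2 : (0 : ℝ) < ((ℓ + R : ℕ) : ℝ) - ℓ := by
    push_cast
    have : (0 : ℝ) < R := by exact_mod_cast hR
    linarith
  rw [div_lt_div_iff₀ h1 h2] at h
  push_cast at h
  have : ((R * E.card + M * ℓ : ℕ) : ℝ) < ((M * U.card + R : ℕ) : ℝ) := by
    push_cast
    linarith
  exact_mod_cast this

theorem IsIsomorphic.isTight {F : LGraph ℓ W} (hF : F.IsTight R M)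
    (h : F.IsIsomorphic C) : C.IsTight R M := by
  classical
  obtain ⟨f, hf⟩ := h
  have hcv : C.verts.card = F.verts.card := by
    have := Fintype.card_congr f
    simpa using this.symm
  let pull : Finset V → Finset W := fun U =>
    ((U.subtype (· ∈ C.verts)).map f.symm.toEmbedding).map (Function.Embedding.subtype _)
  have pull_card : ∀ U ⊆ C.verts, (pull U).card = U.card := by
    intro U hU
    simp only [pull, Finset.card_map, Finset.card_subtype]
    rw [Finset.filter_true_of_mem hU]
  have pull_mono : ∀ U U', U ⊆ U' → pull U ⊆ pull U' := by
    intro U U' h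
    simp only [pull, Finset.map_subset_map]
    exact Finset.subtype_mono h
  have pull_inj : ∀ U ⊆ C.verts, ∀ U' ⊆ C.verts, pull U = pull U' → U = U' := by
    intro U hU U' hU' h
    have h' := Finset.map_injective _ (Finset.map_injective _ h)
    have h2 := congrArg (Finset.map (Function.Embedding.subtype _)) h'
    rwa [Finset.subtype_map_of_mem hU, Finset.subtype_map_of_mem hU'] at h2
  have pull_sub : ∀ U, pull U ⊆ F.verts := by
    intro U x hx
    simp only [pull, Finset.mem_map] at hx
    obtain ⟨y, -, rfl⟩ := hx
    exact y.2
  have pull_edge : ∀ U ⊆ C.verts, (pull U ∈ F.edges ↔ U ∈ C.edges) := by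
    intro U hU
    simp only [pull]
    rw [hf]
    have : ((U.subtype (· ∈ C.verts)).map f.symm.toEmbedding).map f.toEmbedding
        = U.subtype (· ∈ C.verts) := by
      rw [Finset.map_map]
      convert Finset.map_refl
      ext x; simp
    rw [this, Finset.subtype_map_of_mem hU]
  have pull_surj : ∀ U ⊆ F.verts, ∃ U' ⊆ C.verts, pull U' = U := by
    intro U hU
    refine ⟨((U.subtype (· ∈ F.verts)).map f.toEmbedding).map (Function.Embedding.subtype _),
      ?_, ?_⟩
    · intro x hx
      simp only [Finset.mem_map] at hx
      obtain ⟨y, -, rfl⟩ := hx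
      exact y.2
    · ext x
      simp only [pull, Finset.mem_map, Finset.mem_subtype]
      constructor
      · rintro ⟨a, ⟨b, ⟨c, ⟨d, hd, rfl⟩, hc⟩, rfl⟩, rfl⟩
        have : f d = b := Subtype.ext hc
        simpa [← this] using hd
      · intro hx
        exact ⟨⟨x, hU hx⟩, ⟨f ⟨x, hU hx⟩, ⟨f ⟨x, hU hx⟩, ⟨⟨x, hU hx⟩, hx, rfl⟩, rfl⟩, by simp⟩, rfl⟩
  have himg : C.edges.image pull = F.edges := by
    ext U
    rw [Finset.mem_image]
    constructor
    · rintro ⟨U', hU', rfl⟩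
      exact (pull_edge U' (C.edge_subset _ hU')).2 hU'
    · intro hU
      obtain ⟨U', hU', rfl⟩ := pull_surj U (F.edge_subset _ hU)
      exact ⟨U', (pull_edge U' hU').1 hU, rfl⟩
  have inj : ∀ E ⊆ C.edges, (E.image pull).card = E.card := fun E hE =>
    Finset.card_image_of_injOn fun a ha b hb hab =>
      pull_inj a (C.edge_subset _ (hE ha)) b (C.edge_subset _ (hE hb)) hab
  have hce : C.edges.card = F.edges.card := by rw [← himg, inj _ subset_rfl]
  refine ⟨hcv.trans hF.card_verts, hce.trans hF.card_edges, fun U E hU hE hEU hUc hne => ?_⟩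
  have := hF.strict (pull U) (E.image pull) (pull_sub U)
    (himg ▸ Finset.image_subset_image hE)
    (by
      intro g hg
      obtain ⟨g', hg', rfl⟩ := Finset.mem_image.1 hg
      exact pull_mono _ _ (hEU g' hg'))
    (by rwa [pull_card U hU])
    (by
      rcases hne with h | h
      · left
        intro h'
        exact h (Finset.eq_of_subset_of_card_le hU (by rw [← pull_card U hU, h', hcv]))
      · right
        intro h'
        exact h (Finset.eq_of_subset_of_card_le hE (by rw [← inj E hE, h', hce])))
  rwa [pull_card U hU, inj E hE] at this

end Tight

/-! ### The cut lemma -/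

section Cut

variable {ℓ : ℕ} {V : Type*} [DecidableEq V] {A C : LGraph ℓ V} {R M : ℕ}

/-- The cut lemma: let `A` and `C` be copies such that the part of `A` outside `C` meets `C` only
within the edge `e` of `C`, and suppose `A` has an edge of `C` other than `e`. Then `A = C`, or `A`
arises from `C` by replacing `e` with another edge `e'`, whose intersection with `e` is too large
for two edges of one copy (see `IsTight.two_edges`). The part of `A` inside `C`, completed by `e`, and
the part of `A` outside `C` together have `v(F) + ℓ` vertices and `e(F) + 1` edges, so both attain
equality in `IsTight.le`. -/
theorem IsTight.cut (hA : A.IsTight R M) (hC : C.IsTight R M) (hR : 0 < R) (hM : 2 ≤ M)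
    {e : Finset V} (he : e ∈ C.edges)
    (hcut : ∀ f ∈ A.edges, f ∈ C.edges ∨ f ∩ C.verts ⊆ e)
    (hmeet : ∃ f ∈ A.edges, f ∈ C.edges ∧ f ≠ e) :
    A = C ∨ ∃ e' ∈ A.edges, e' ∉ C.edges ∧ A.edges = insert e' (C.edges.erase e) ∧
      M * (ℓ - (e ∩ e').card) < R := by
  obtain ⟨f₀, hf₀A, hf₀C, hf₀e⟩ := hmeet
  have heV := C.edge_subset e he
  have hec := C.edge_card e he
  -- `(U₁, E₁)` is the part of `A` inside `C` completed by `e`, and `(U₂, E₂)` the part of `A`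
  -- outside `C`; vertices of `e` count for both.
  set X := (C.verts ∩ A.verts) \ e with hX
  set Y := (A.edges ∩ C.edges).erase e with hY
  set U₁ := X ∪ e with hU₁
  set E₁ := insert e Y with hE₁
  set U₂ := A.verts \ X with hU₂
  set E₂ := A.edges \ Y with hE₂
  have hXA : X ⊆ A.verts := fun x hx => by simp [hX] at hx; tauto
  have hYA : Y ⊆ A.edges := fun x hx => by simp [hY] at hx; tauto
  have hYC : Y ⊆ C.edges := fun x hx => by simp [hY] at hx; tauto
  have cU₁ : U₁.card = X.card + ℓ := by
    rw [hU₁, Finset.card_union_of_disjoint Finset.sdiff_disjoint, hec]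
  have cE₁ : E₁.card = Y.card + 1 := Finset.card_insert_of_notMem (Finset.notMem_erase _ _)
  have cU₂ : U₂.card + X.card = ℓ + R := by
    rw [hU₂, Finset.card_sdiff_add_card_eq_card hXA, hA.card_verts]
  have cE₂ : E₂.card + Y.card = M + 1 := by
    rw [hE₂, Finset.card_sdiff_add_card_eq_card hYA, hA.card_edges]
  have sU₁ : U₁ ⊆ C.verts := Finset.union_subset (fun x hx => by simp [hX] at hx; tauto) heV
  have sE₁ : E₁ ⊆ C.edges := Finset.insert_subset he hYC
  have sEU₁ : ∀ f ∈ E₁, f ⊆ U₁ := by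
    intro f hf x hx
    rw [hE₁, Finset.mem_insert] at hf
    by_cases hxe : x ∈ e
    · simp [hU₁, hxe]
    · rcases hf with rfl | hf
      · exact absurd hx hxe
      · simp [hU₁, hX, hxe, C.edge_subset f (hYC hf) hx, A.edge_subset f (hYA hf) hx]
  have sEU₂ : ∀ f ∈ E₂, f ⊆ U₂ := by
    intro f hf x hx
    simp only [hE₂, hY, Finset.mem_sdiff, Finset.mem_erase, Finset.mem_inter, not_and] at hf
    simp only [hU₂, hX, Finset.mem_sdiff, Finset.mem_inter, not_and, not_not]
    refine ⟨A.edge_subset f hf.1 hx, fun hxx => ?_⟩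
    by_cases hfe : f = e
    · exact hfe ▸ hx
    · rcases hcut f hf.1 with h | h
      · exact absurd h (hf.2 hfe hf.1)
      · exact h (by simp [hx, hxx.1])
  have h₁ := hC.le sU₁ sE₁ sEU₁ (by omega)
  have hYcard : Y.card + 1 ≤ M + 1 := by
    rw [← cE₁, ← hC.card_edges]; exact Finset.card_le_card sE₁
  obtain ⟨e', he'⟩ : E₂.Nonempty := Finset.card_pos.1 (by omega)
  have he'A : e' ∈ A.edges := (Finset.mem_sdiff.1 he').1
  have hU₂c : ℓ ≤ U₂.card := by
    rw [← A.edge_card e' he'A]; exact Finset.card_le_card (sEU₂ e' he')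
  have h₂ := hA.le (U := U₂) (E := E₂) Finset.sdiff_subset Finset.sdiff_subset sEU₂ hU₂c
  have hs1 : U₁.card + U₂.card = 2 * ℓ + R := by omega
  have hs2 : E₁.card + E₂.card = M + 2 := by omega
  have e1 : M * U₁.card + M * U₂.card = 2 * (M * ℓ) + R * M := by rw [← mul_add, hs1]; ring
  have e2 : R * E₁.card + R * E₂.card = R * M + 2 * R := by rw [← mul_add, hs2]; ring
  have hf₀Y : f₀ ∈ Y := by simp [*]
  have hall : U₁ = C.verts ∧ E₁ = C.edges := by
    rcases hC.eq_or hR sU₁ sE₁ sEU₁ (by omega) (by omega) with h | h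
    · exact h
    · have := Finset.card_pos.2 ⟨f₀, hf₀Y⟩
      omega
  have cY : Y.card = M := by
    have := hC.card_edges
    rw [← hall.2] at this; omega
  have hE₂1 : E₂ = {e'} := by
    obtain ⟨a, ha⟩ := Finset.card_eq_one.1 (show E₂.card = 1 by omega)
    rw [ha] at he' ⊢
    rw [Finset.mem_singleton.1 he']
  have hYeq : Y = C.edges.erase e := by
    rw [← hall.2, hE₁, Finset.erase_insert (Finset.notMem_erase _ _)]
  have hAE : A.edges = insert e' (C.edges.erase e) := by
    rw [← hYeq, ← Finset.sdiff_union_of_subset hYA, ← hE₂, hE₂1]; rfl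
  by_cases hee : e' = e
  · left
    refine hA.eq_of_edges_eq hC hR (by omega) ?_
    rw [hAE, hee, Finset.insert_erase he]
  · right
    have he'C : e' ∉ C.edges := by
      intro h
      have : e' ∈ Y := by simp [hYeq, h, hee]
      exact (Finset.mem_sdiff.1 he').2 this
    refine ⟨e', he'A, he'C, hAE, ?_⟩
    have hU₂ℓ : U₂.card = ℓ := by
      rcases hA.eq_or hR (U := U₂) (E := E₂) Finset.sdiff_subset Finset.sdiff_subset sEU₂ hU₂c
        (by omega) with h | h
      · have := hA.card_edges
        rw [← h.2, hE₂1] at this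
        simp at this; omega
      · exact h.1
    have hU₂e : e' = U₂ := Finset.eq_of_subset_of_card_le (sEU₂ e' he')
      (by rw [hU₂ℓ, A.edge_card e' he'A])
    -- The bound on `e ∩ e'` is the density condition for the common part of `A` and `C`.
    have heA : e ∩ A.verts = e ∩ e' := by
      ext x
      rw [hU₂e]
      simp only [hU₂, hX, Finset.mem_inter, Finset.mem_sdiff]
      tauto
    have hJ : (C.verts ∩ A.verts) = X ∪ (e ∩ e') := by
      rw [← heA]
      ext x
      simp only [hX, Finset.mem_inter, Finset.mem_union, Finset.mem_sdiff]
      have : x ∈ e → x ∈ C.verts := fun h => heV h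
      tauto
    have hJc : (C.verts ∩ A.verts).card = X.card + (e ∩ e').card := by
      rw [hJ]
      refine Finset.card_union_of_disjoint (Finset.disjoint_left.2 fun x hx hx' => ?_)
      simp [hX] at hx hx'
      tauto
    have hXc : X.card = R := by omega
    have hk : (e ∩ e').card ≤ ℓ := by
      rw [← hec]; exact Finset.card_le_card Finset.inter_subset_left
    have hsubJ : ∀ f ∈ Y, f ⊆ C.verts ∩ A.verts := fun f hf =>
      Finset.subset_inter (C.edge_subset f (hYC hf)) (A.edge_subset f (hYA hf))
    have hJℓ : ℓ < (C.verts ∩ A.verts).card := by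
      by_contra! hle
      have hge : ℓ ≤ (C.verts ∩ A.verts).card :=
        (C.edge_card f₀ hf₀C).symm.trans_le (Finset.card_le_card (hsubJ f₀ hf₀Y))
      have := card_le_one_of_card_eq hYC hsubJ (le_antisymm hle hge)
      omega
    have hfin := hC.strict _ Y Finset.inter_subset_left hYC hsubJ hJℓ
      (Or.inr (by intro h; rw [h] at cY; have := hC.card_edges; omega))
    rw [hJc, hXc, cY] at hfin
    obtain ⟨d, hd⟩ : ∃ d, ℓ = (e ∩ e').card + d := ⟨ℓ - (e ∩ e').card, by omega⟩
    have hd' : ℓ - (e ∩ e').card = d := by omega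
    rw [hd']
    have h5 : M * ℓ = M * (e ∩ e').card + M * d := by rw [← mul_add, ← hd]
    have h6 : M * (R + (e ∩ e').card) = R * M + M * (e ∩ e').card := by ring
    omega

/-- A bound on the intersection of two edges of a copy, from the density of the graph that they
form. -/
theorem IsTight.two_edges (hC : C.IsTight R M) {e f : Finset V} (he : e ∈ C.edges)
    (hf : f ∈ C.edges) (hef : e ≠ f) : R ≤ M * (ℓ - (e ∩ f).card) := by
  have he' := C.edge_card e he
  have hf' := C.edge_card f hf
  have hcard : (e ∪ f).card + (e ∩ f).card = ℓ + ℓ := by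
    rw [Finset.card_union_add_card_inter, he', hf']
  have hk : (e ∩ f).card ≤ ℓ := by
    rw [← he']; exact Finset.card_le_card Finset.inter_subset_left
  have h := hC.le (U := e ∪ f) (E := {e, f})
    (Finset.union_subset (C.edge_subset e he) (C.edge_subset f hf))
    (by simp [Finset.insert_subset_iff, he, hf])
    (by simp)
    (by omega)
  rw [Finset.card_pair hef] at h
  have : (e ∪ f).card = ℓ + (ℓ - (e ∩ f).card) := by omega
  rw [this, mul_add] at h
  omega

theorem IsTight.le_of_gamma (hC : C.IsTight R M) (hM : 0 < M) (hg : C.gamma + 1 = ℓ) :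
    R ≤ M := by
  classical
  have hne : C.edges.offDiag.Nonempty := by
    have : 1 < C.edges.card := by rw [hC.card_edges]; omega
    obtain ⟨a, ha, b, hb, hab⟩ := Finset.one_lt_card.1 this
    exact ⟨(a, b), by simp [ha, hb, hab]⟩
  obtain ⟨q, hq, hq'⟩ := Finset.exists_mem_eq_sup _ hne fun q : Finset V × Finset V =>
    (q.1 ∩ q.2).card
  rw [Finset.mem_offDiag] at hq
  have h := hC.two_edges hq.1 hq.2.1 hq.2.2
  have hγ : C.gamma = (q.1 ∩ q.2).card := by
    rw [← hq', gamma]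
    congr!
  rw [← hγ] at h
  have : ℓ - C.gamma = 1 := by omega
  rw [this] at h
  omega

end Cut


/-! ### Copies that are not closed -/

section Closed

variable {ℓ : ℕ} {V W : Type*} {F : LGraph ℓ W} {A C D G : LGraph ℓ V} {R M : ℕ}

theorem IsCopyIn.isTight (hF : F.IsTight R M) (h : F.IsCopyIn C G) : C.IsTight R M :=
  h.2.isTight hF

theorem isCopyIn_of_edges (hF : F.IsTight R M) (hR : 0 < R) (hM : 0 < M)
    (h : F.IsIsomorphic C) (he : C.edges ⊆ G.edges) : F.IsCopyIn C G :=
  ⟨⟨(h.isTight hF).verts_subset_of_edges hR hM he, he⟩, h⟩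

/-- If every copy that has an edge of `C` outside `S` contains all edges of `C` outside `S`, and is
`C` itself when `R ≤ M`, then only edges in `S` can be closed: for `γ(F) = ℓ - 1` the others lie in
one copy only, and for `γ(F) < ℓ - 1` they are equivalent to each other. -/
theorem not_copyClosed_of_rigid [DecidableEq V] (hC : F.IsCopyIn C G)
    (hlt : F.gamma + 1 < ℓ → 3 ≤ M) (hcard : C.edges.card = M + 1) (heq : F.gamma + 1 = ℓ → R ≤ M)
    (S : Finset (Finset V)) (hS : S.card ≤ 2)
    (h : ∀ A, F.IsCopyIn A G → ∀ f ∈ A.edges, f ∈ C.edges → f ∉ S →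
      C.edges \ S ⊆ A.edges ∧ (R ≤ M → A = C)) : ¬ F.CopyClosed G C := by
  rintro ⟨T, hTC, hT3, hT⟩
  obtain ⟨f, hfT, hfS⟩ := Finset.exists_mem_notMem_of_card_lt_card (show S.card < T.card by omega)
  have hfC := hTC hfT
  obtain ⟨-, ⟨hg, F₁, F₂, hne, h₁, h₂, hf₁, hf₂⟩ | ⟨hg, -, h'⟩⟩ := hT f hfT
  · exact hne (((h F₁ h₁ f hf₁ hfC hfS).2 (heq hg)).trans
      ((h F₂ h₂ f hf₂ hfC hfS).2 (heq hg)).symm)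
  · have hM := hlt hg
    have h2 : 1 < (C.edges \ S).card := by
      have := Finset.le_card_sdiff S C.edges
      omega
    obtain ⟨f', hf', hff⟩ := Finset.exists_mem_ne h2 f
    rw [Finset.mem_sdiff] at hf'
    refine h' f' (hC.1.2 hf'.1) hff fun A hA => ⟨fun hfA => ?_, fun hfA => ?_⟩
    · exact (h A hA f hfA hfC hfS).1 (Finset.mem_sdiff.2 hf')
    · exact (h A hA f' hfA hf'.1 hf'.2).1 (Finset.mem_sdiff.2 ⟨hfC, hfS⟩)

theorem rigid_of_cut [DecidableEq V] (hF : F.IsTight R M) (hR : 0 < R) (hM : 2 ≤ M)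
    (hA : F.IsIsomorphic A) (hC : F.IsIsomorphic C) {e : Finset V} (he : e ∈ C.edges)
    (hcut : ∀ f ∈ A.edges, f ∈ C.edges ∨ f ∩ C.verts ⊆ e)
    {f : Finset V} (hfA : f ∈ A.edges) (hfC : f ∈ C.edges) (hfe : f ≠ e) :
    C.edges.erase e ⊆ A.edges ∧ (R ≤ M → A = C) := by
  rcases (hA.isTight hF).cut (hC.isTight hF) hR hM he hcut ⟨f, hfA, hfC, hfe⟩ with
    rfl | ⟨e', he'A, he'C, h, hlt⟩
  · exact ⟨Finset.erase_subset _ _, fun _ => rfl⟩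
  · refine ⟨h ▸ Finset.subset_insert _ _, fun hRM => ?_⟩
    exfalso
    -- If `R ≤ M`, the intersection bound would force `e = e'`.
    have hlt' : (e ∩ e').card < e.card := by
      refine Finset.card_lt_card ⟨Finset.inter_subset_left, fun hsub => he'C ?_⟩
      have : e ⊆ e' := fun x hx => (Finset.mem_inter.1 (hsub hx)).2
      rwa [← Finset.eq_of_subset_of_card_le this
        (by rw [A.edge_card e' he'A, C.edge_card e he])]
    rw [C.edge_card e he] at hlt'
    have : M * 1 ≤ M * (ℓ - (e ∩ e').card) := Nat.mul_le_mul_left _ (by omega)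
    omega

/-- A copy `C` that the rest of `G` meets within a single edge is not closed in `G`. -/
theorem not_copyClosed_of_pendant [DecidableEq V] (hF : F.IsTight R M) (hR : 0 < R) (hM : 2 ≤ M)
    (hlt : F.gamma + 1 < ℓ → 3 ≤ M) (heq : F.gamma + 1 = ℓ → R ≤ M)
    (hC : F.IsCopyIn C G) {e : Finset V} (he : e ∈ C.edges)
    (hcut : ∀ f ∈ G.edges, f ∈ C.edges ∨ f ∩ C.verts ⊆ e) : ¬ F.CopyClosed G C := by
  refine not_copyClosed_of_rigid hC hlt (hC.isTight hF).card_edges heq {e} (by simp)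
    fun A hA f hfA hfC hfe => ?_
  rw [Finset.sdiff_singleton_eq_erase]
  exact rigid_of_cut hF hR hM hA.2 hC.2 he (fun f hf => hcut f (hA.1.2 hf)) hfA hfC
    (by simpa using hfe)

/-- A copy `C` is not closed in `G` if `C` is pendant in `G₀` and `G` arises from `G₀` by attaching
a single copy `D` along an edge `g` of `C`. -/
theorem not_copyClosed_of_touched [DecidableEq V] (hF : F.IsTight R M) (hR : 0 < R) (hM : 2 ≤ M)
    (hlt : F.gamma + 1 < ℓ → 3 ≤ M) (heq : F.gamma + 1 = ℓ → R ≤ M)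
    {G₀ : LGraph ℓ V} (hC : F.IsCopyIn C G₀) (hG₀ : G₀.IsSubgraph G) {e : Finset V}
    (he : e ∈ C.edges) (hcut : ∀ f ∈ G₀.edges, f ∈ C.edges ∨ f ∩ C.verts ⊆ e)
    (hD : F.IsIsomorphic D) (hG : ∀ f ∈ G.edges, f ∈ G₀.edges ∨ f ∈ D.edges)
    {g : Finset V} (hgC : g ∈ C.edges) (hgD : g ∈ D.edges)
    (hcut' : ∀ f ∈ G₀.edges, f ∩ D.verts ⊆ g) : ¬ F.CopyClosed G C := by
  have hCG : F.IsCopyIn C G := ⟨⟨hC.1.1.trans hG₀.1, hC.1.2.trans hG₀.2⟩, hC.2⟩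
  refine not_copyClosed_of_rigid hCG hlt (hC.isTight hF).card_edges heq {e, g}
    Finset.card_le_two fun A hA f hfA hfC hfS => ?_
  simp only [Finset.mem_insert, Finset.mem_singleton, not_or] at hfS
  have hfD : f ∉ D.edges := fun hfD => by
    have h1 := hcut' f (hC.1.2 hfC)
    rw [Finset.inter_eq_left.2 (D.edge_subset f hfD)] at h1
    exact hfS.2 (Finset.eq_of_subset_of_card_le h1 (by rw [C.edge_card g hgC, C.edge_card f hfC]))
  have hAG₀ : ∀ f ∈ A.edges, f ∈ G₀.edges := by
    intro a haA
    by_contra ha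
    have haD := (hG a (hA.1.2 haA)).resolve_left ha
    have hag : a ≠ g := fun h => ha (h ▸ hC.1.2 hgC)
    rcases (hA.isTight hF).cut (hD.isTight hF) hR hM hgD
      (fun b hb => (hG b (hA.1.2 hb)).symm.imp_right (hcut' b)) ⟨a, haA, haD, hag⟩ with
      rfl | ⟨e', he'A, he'D, h, hlt'⟩
    · exact hfD hfA
    · have hfe' : f = e' := by
        rw [h, Finset.mem_insert] at hfA
        exact hfA.resolve_right fun h' => hfD (Finset.mem_of_mem_erase h')
      subst hfe'
      -- `f` and `g` are two edges of `C`, so they cannot intersect in that many vertices.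
      have := (hC.isTight hF).two_edges hgC hfC (Ne.symm hfS.2)
      omega
  have := rigid_of_cut hF hR hM hA.2 hC.2 he (fun b hb => hcut b (hAG₀ b hb)) hfA hfC hfS.1
  refine ⟨fun b hb => this.1 ?_, this.2⟩
  simp at hb ⊢
  tauto

/-- An edge that is new in `G'` is not equivalent to `e`, as `e` lies in a copy in `G`. -/
theorem EdgeClosed.mono {G G' : LGraph ℓ V}
    (h : G.IsSubgraph G') {e : Finset V} (he : F.EdgeClosed G e) : F.EdgeClosed G' e := by
  have lift : ∀ {A}, F.IsCopyIn A G → F.IsCopyIn A G' := fun hA =>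
    ⟨⟨hA.1.1.trans h.1, hA.1.2.trans h.2⟩, hA.2⟩
  have two : F.InTwoCopies G e → F.InTwoCopies G' e := fun ⟨F₁, F₂, hne, h₁, h₂, h⟩ =>
    ⟨F₁, F₂, hne, lift h₁, lift h₂, h⟩
  refine ⟨h.2 he.1, he.2.imp (fun h => ⟨h.1, two h.2⟩) fun ⟨h1, h2, h3⟩ => ⟨h1, two h2, ?_⟩⟩
  intro e' he' hne heq
  by_cases h' : e' ∈ G.edges
  · exact h3 e' h' hne fun A hA => heq A (lift hA)
  · obtain ⟨F₁, -, -, hF₁, -, heF₁, -⟩ := h2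
    exact h' (hF₁.1.2 ((heq F₁ (lift hF₁)).1 heF₁))

theorem CopyClosed.mono {G G' : LGraph ℓ V}
    (h : G.IsSubgraph G') (hC : F.CopyClosed G C) : F.CopyClosed G' C := by
  obtain ⟨T, h1, h2, h3⟩ := hC
  exact ⟨T, h1, h2, fun e he => (h3 e he).mono h⟩

end Closed


/-! ### Histories and the potential -/

section History

variable {ℓ : ℕ} {V W : Type*} [DecidableEq V] {F : LGraph ℓ W} {R M : ℕ}

/-- The union of a list of `ℓ`-graphs. -/
def hull : List (LGraph ℓ V) → LGraph ℓ V
  | [] => ⟨∅, ∅, by simp, by simp⟩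
  | C :: h => ⟨C.verts ∪ (hull h).verts, C.edges ∪ (hull h).edges, fun e he => by
      rcases Finset.mem_union.1 he with h' | h'
      · exact (C.edge_subset e h').trans Finset.subset_union_left
      · exact ((hull h).edge_subset e h').trans Finset.subset_union_right, fun e he => by
      rcases Finset.mem_union.1 he with h' | h'
      · exact C.edge_card e h'
      · exact (hull h).edge_card e h'⟩

theorem mem_hull_verts {h : List (LGraph ℓ V)} {x : V} :
    x ∈ (hull h).verts ↔ ∃ C ∈ h, x ∈ C.verts := by
  induction h with
  | nil => simp [hull]
  | cons C h ih => simp [hull, ih]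

theorem mem_hull_edges {h : List (LGraph ℓ V)} {e : Finset V} :
    e ∈ (hull h).edges ↔ ∃ C ∈ h, e ∈ C.edges := by
  induction h with
  | nil => simp [hull]
  | cons C h ih => simp [hull, ih]

theorem isSubgraph_hull {h : List (LGraph ℓ V)} {C : LGraph ℓ V} (hC : C ∈ h) :
    C.IsSubgraph (hull h) :=
  ⟨fun _ hx => mem_hull_verts.2 ⟨C, hC, hx⟩, fun _ hx => mem_hull_edges.2 ⟨C, hC, hx⟩⟩

theorem hull_isSubgraph_cons (C : LGraph ℓ V) (h : List (LGraph ℓ V)) :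
    (hull h).IsSubgraph (hull (C :: h)) :=
  ⟨Finset.subset_union_right, Finset.subset_union_right⟩

open Classical in
variable (F) in
/-- The oldest member of the history `h` that is not closed in the hull of `h`. Histories list the
latest copy first, whence the reversal. -/
noncomputable def oldestOpen (h : List (LGraph ℓ V)) : Option (LGraph ℓ V) :=
  h.reverse.find? fun C => ¬ F.CopyClosed (hull h) C

variable (F) in
/-- The edges to one of which the next copy has to be attached. -/
noncomputable def anchor (h : List (LGraph ℓ V)) : Finset (Finset V) :=
  match F.oldestOpen h with
  | some J => J.edges
  | none => (hull h).edges

variable (F) in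
/-- The possible explorations, latest copy first: each new copy brings a new edge and contains an
edge of the anchor. -/
inductive IsHistory : List (LGraph ℓ V) → Prop
  | single (C : LGraph ℓ V) : F.IsIsomorphic C → IsHistory [C]
  | cons (C : LGraph ℓ V) (h : List (LGraph ℓ V)) : IsHistory h → F.IsIsomorphic C →
      ¬ C.edges ⊆ (hull h).edges → (∃ e ∈ C.edges, e ∈ F.anchor h) → IsHistory (C :: h)

/-- The copy `C`, attached to the history `h`, meets its hull in at most `ℓ` vertices. As `C` shares
an edge with the hull, it then meets the hull exactly in this edge. -/
def IsRegularStep (C : LGraph ℓ V) (h : List (LGraph ℓ V)) : Prop :=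
  (C.verts ∩ (hull h).verts).card ≤ ℓ

/-- The other members of `h` meet the member `D` within one edge of `D`. -/
def IsPendant (h : List (LGraph ℓ V)) (D : LGraph ℓ V) : Prop :=
  D ∈ h ∧ ∃ e ∈ D.edges, ∀ C ∈ h, C ≠ D → C.verts ∩ D.verts ⊆ e

open Classical in
/-- The set of pendant members of a history. -/
noncomputable def pendants (h : List (LGraph ℓ V)) : Finset (LGraph ℓ V) :=
  h.toFinset.filter (IsPendant h)

theorem mem_pendants {h : List (LGraph ℓ V)} {D : LGraph ℓ V} :
    D ∈ pendants h ↔ IsPendant h D := by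
  simp only [pendants, Finset.mem_filter, List.mem_toFinset, and_iff_right_iff_imp]
  exact fun h => h.1

open Classical in
variable (F) in
/-- Twice the number of pendant members, plus one if the oldest open member exists and is not
pendant. The second term makes up for a regular step at a pendant oldest open member, which creates
one pendant member but destroys another. -/
noncomputable def potential (h : List (LGraph ℓ V)) : ℕ :=
  2 * (pendants h).card + if ∃ J, F.oldestOpen h = some J ∧ ¬ IsPendant h J then 1 else 0

open Classical in
/-- The number of regular steps of a history. Its first copy counts as a regular step, the empty
hull being met in no vertex. -/
noncomputable def regCount : List (LGraph ℓ V) → ℕ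
  | [] => 0
  | C :: h => regCount h + if IsRegularStep C h then 1 else 0

open Classical in
/-- The number of degenerate steps of a history. -/
noncomputable def degCount : List (LGraph ℓ V) → ℕ
  | [] => 0
  | C :: h => degCount h + if IsRegularStep C h then 0 else 1

open Classical in
variable (F) in
/-- The number of regular steps taken when all members were closed, including the first copy. -/
noncomputable def freeCount : List (LGraph ℓ V) → ℕ
  | [] => 0
  | C :: h => freeCount h + if IsRegularStep C h ∧ F.oldestOpen h = none then 1 else 0

open Classical in
variable (F) in
/-- The number of regular steps attached to an oldest open member. -/
noncomputable def boundCount : List (LGraph ℓ V) → ℕ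
  | [] => 0
  | C :: h => boundCount h + if IsRegularStep C h ∧ F.oldestOpen h ≠ none then 1 else 0

theorem regCount_add_degCount (h : List (LGraph ℓ V)) : regCount h + degCount h = h.length := by
  induction h with
  | nil => rfl
  | cons C h ih =>
    simp only [regCount, degCount, List.length_cons]
    split_ifs <;> omega

theorem boundCount_add_freeCount (h : List (LGraph ℓ V)) :
    F.boundCount h + F.freeCount h = regCount h := by
  induction h with
  | nil => rfl
  | cons C h ih =>
    simp only [regCount, boundCount, freeCount]
    by_cases h1 : IsRegularStep C h <;> by_cases h2 : F.oldestOpen h = none <;> simp [h1, h2] <;>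
      omega

theorem mem_of_oldestOpen {h : List (LGraph ℓ V)} {J : LGraph ℓ V} (hJ : F.oldestOpen h = some J) :
    J ∈ h := by
  simpa using List.mem_of_find?_eq_some hJ

theorem not_closed_of_oldestOpen {h : List (LGraph ℓ V)} {J : LGraph ℓ V}
    (hJ : F.oldestOpen h = some J) : ¬ F.CopyClosed (hull h) J := by
  simpa using List.find?_some hJ

theorem oldestOpen_eq_none {h : List (LGraph ℓ V)} :
    F.oldestOpen h = none ↔ ∀ C ∈ h, F.CopyClosed (hull h) C := by
  simp [oldestOpen]

theorem _root_.List.find?_eq_some_of_imp {α : Type*} {p q : α → Bool} {l : List α} {a : α}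
    (h : l.find? p = some a) (hq : q a = true) (hqp : ∀ x ∈ l, q x = true → p x = true) :
    l.find? q = some a := by
  induction l with
  | nil => simp at h
  | cons b l ih =>
    rw [List.find?_cons] at h ⊢
    cases hb : p b with
    | true =>
      simp [hb] at h
      subst h
      simp [hq]
    | false =>
      rw [hb] at h
      have hqb : q b = false := by
        by_contra h'
        have := hqp b (by simp) (by simpa using h')
        simp [hb] at this
      rw [hqb]
      exact ih h fun x hx => hqp x (by simp [hx])

/-- As closedness persists, the oldest open member remains the oldest one while it is open. -/
theorem oldestOpen_cons {h : List (LGraph ℓ V)} {C J : LGraph ℓ V} (hJ : F.oldestOpen h = some J)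
    (hJ' : ¬ F.CopyClosed (hull (C :: h)) J) : F.oldestOpen (C :: h) = some J := by
  classical
  unfold oldestOpen at hJ ⊢
  rw [List.reverse_cons, List.find?_append, List.find?_eq_some_of_imp hJ (by simpa using hJ'),
    Option.some_or]
  intro x _ hx
  have hx' : ¬ F.CopyClosed (hull (C :: h)) x := by simpa using hx
  simpa using fun hc => hx' (CopyClosed.mono (hull_isSubgraph_cons C h) hc)

theorem anchor_subset (h : List (LGraph ℓ V)) : F.anchor h ⊆ (hull h).edges := by
  unfold anchor
  split
  · next J hJ => exact (isSubgraph_hull (mem_of_oldestOpen hJ)).2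
  · exact subset_rfl

theorem IsHistory.isIsomorphic {h : List (LGraph ℓ V)} (hh : F.IsHistory h) {C : LGraph ℓ V}
    (hC : C ∈ h) : F.IsIsomorphic C := by
  induction hh with
  | single D hD => rw [List.mem_singleton] at hC; exact hC ▸ hD
  | cons D h _ hD _ _ ih =>
    rcases List.mem_cons.1 hC with rfl | h'
    · exact hD
    · exact ih h'

theorem IsHistory.isCopyIn {h : List (LGraph ℓ V)} (hh : F.IsHistory h) {C : LGraph ℓ V}
    (hC : C ∈ h) : F.IsCopyIn C (hull h) :=
  ⟨isSubgraph_hull hC, hh.isIsomorphic hC⟩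

theorem IsPendant.edge_cut {h : List (LGraph ℓ V)} {D : LGraph ℓ V} {e : Finset V}
    (he : ∀ C ∈ h, C ≠ D → C.verts ∩ D.verts ⊆ e) :
    ∀ f ∈ (hull h).edges, f ∈ D.edges ∨ f ∩ D.verts ⊆ e := by
  intro f hf
  obtain ⟨C, hC, hfC⟩ := mem_hull_edges.1 hf
  by_cases hCD : C = D
  · exact Or.inl (hCD ▸ hfC)
  · exact Or.inr ((Finset.inter_subset_inter_right (C.edge_subset f hfC)).trans (he C hC hCD))

theorem IsHistory.pendant_open {h : List (LGraph ℓ V)} (hh : F.IsHistory h) (hF : F.IsTight R M)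
    (hR : 0 < R) (hM : 2 ≤ M) (hlt : F.gamma + 1 < ℓ → 3 ≤ M) (heq : F.gamma + 1 = ℓ → R ≤ M)
    {D : LGraph ℓ V} (hD : IsPendant h D) : ¬ F.CopyClosed (hull h) D := by
  obtain ⟨hDh, e, he, hcut⟩ := hD
  exact not_copyClosed_of_pendant hF hR hM hlt heq (hh.isCopyIn hDh) he (IsPendant.edge_cut hcut)

theorem notMem_of_not_edges_subset {h : List (LGraph ℓ V)} {C : LGraph ℓ V}
    (hC : ¬ C.edges ⊆ (hull h).edges) : C ∉ h :=
  fun h' => hC (isSubgraph_hull h').2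

theorem IsRegularStep.inter_eq {C : LGraph ℓ V} {h : List (LGraph ℓ V)} (hr : IsRegularStep C h)
    {e : Finset V} (heC : e ∈ C.edges) (he : e ∈ (hull h).edges) :
    C.verts ∩ (hull h).verts = e := by
  refine (Finset.eq_of_subset_of_card_le
    (Finset.subset_inter (C.edge_subset e heC) ((hull h).edge_subset e he)) ?_).symm
  rw [C.edge_card e heC]
  exact hr

theorem IsRegularStep.isPendant {C : LGraph ℓ V} {h : List (LGraph ℓ V)} (hr : IsRegularStep C h)
    {e : Finset V} (heC : e ∈ C.edges) (he : e ∈ (hull h).edges) : IsPendant (C :: h) C := by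
  refine ⟨List.mem_cons_self, e, heC, fun D hD hDC => ?_⟩
  have hDh : D ∈ h := (List.mem_cons.1 hD).resolve_left hDC
  rw [← hr.inter_eq heC he, Finset.inter_comm]
  exact Finset.inter_subset_inter_left (isSubgraph_hull hDh).1

/-- If attaching `C` makes `D` non-pendant, then `C` meets `D` outside the edge `d` that separates
`D` from the rest of `h`. -/
theorem IsPendant.exists_of_not_cons {C D : LGraph ℓ V} {h : List (LGraph ℓ V)} {d : Finset V}
    (hDh : D ∈ h) (hd : d ∈ D.edges) (hcut : ∀ C ∈ h, C ≠ D → C.verts ∩ D.verts ⊆ d)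
    (hn : ¬ IsPendant (C :: h) D) : ∃ x ∈ C.verts, x ∈ D.verts ∧ x ∉ d := by
  by_contra! hx
  refine hn ⟨List.mem_cons_of_mem _ hDh, d, hd, fun B hB hBD => ?_⟩
  rcases List.mem_cons.1 hB with rfl | hB
  · exact fun x hx' => hx x (Finset.mem_inter.1 hx').1 (Finset.mem_inter.1 hx').2
  · exact hcut B hB hBD

/-- A regular step along `e` destroys the pendancy of `D` only if no other member contains `e`; so
it destroys at most one pendant member. -/
theorem IsRegularStep.eq_of_destroyed {C D : LGraph ℓ V} {h : List (LGraph ℓ V)}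
    (hr : IsRegularStep C h) {e : Finset V} (heC : e ∈ C.edges) (he : e ∈ (hull h).edges)
    (hD : IsPendant h D) (hn : ¬ IsPendant (C :: h) D) {B : LGraph ℓ V} (hB : B ∈ h)
    (heB : e ∈ B.edges) : B = D := by
  obtain ⟨hDh, d, hd, hcut⟩ := hD
  obtain ⟨x, hxC, hxD, hxd⟩ := IsPendant.exists_of_not_cons hDh hd hcut hn
  by_contra hBD
  have hxe : x ∈ e := by
    rw [← hr.inter_eq heC he]
    exact Finset.mem_inter.2 ⟨hxC, (isSubgraph_hull hDh).1 hxD⟩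
  exact hxd (hcut B hB hBD (Finset.mem_inter.2 ⟨B.edge_subset e heB hxe, hxD⟩))

/-- A regular step increases the potential. -/
theorem potential_add_one_le {h : List (LGraph ℓ V)} (hh : F.IsHistory h) (hF : F.IsTight R M)
    (hR : 0 < R) (hM : 2 ≤ M) (hlt : F.gamma + 1 < ℓ → 3 ≤ M) (heq : F.gamma + 1 = ℓ → R ≤ M)
    {C : LGraph ℓ V} (hC : F.IsIsomorphic C) (hnew : ¬ C.edges ⊆ (hull h).edges)
    (ha : ∃ e ∈ C.edges, e ∈ F.anchor h) (hr : IsRegularStep C h) :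
    F.potential h + 1 ≤ F.potential (C :: h) := by
  classical
  obtain ⟨e, heC, heA⟩ := ha
  have he := anchor_subset h heA
  have hCp := hr.isPendant heC he
  have hCn : C ∉ pendants h := fun h' =>
    notMem_of_not_edges_subset hnew (mem_pendants.1 h').1
  by_cases hall : ∀ D, IsPendant h D → IsPendant (C :: h) D
  -- If no pendant member is destroyed, the new one outweighs the loss of the second term.
  · have hsub : insert C (pendants h) ⊆ pendants (C :: h) := by
      intro D hD
      rcases Finset.mem_insert.1 hD with rfl | hD
      · exact mem_pendants.2 hCp
      · exact mem_pendants.2 (hall D (mem_pendants.1 hD))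
    have := Finset.card_le_card hsub
    rw [Finset.card_insert_of_notMem hCn] at this
    unfold potential
    split_ifs <;> omega
  -- Otherwise a single pendant member is destroyed; it is the oldest open one and stays open.
  · push Not at hall
    obtain ⟨D, hD, hDn⟩ := hall
    have huniq : ∀ B ∈ h, e ∈ B.edges → B = D := fun B hB heB =>
      hr.eq_of_destroyed heC he hD hDn hB heB
    have hsub : insert C ((pendants h).erase D) ⊆ pendants (C :: h) := by
      intro B hB
      rcases Finset.mem_insert.1 hB with rfl | hB
      · exact mem_pendants.2 hCp
      · rw [Finset.mem_erase] at hB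
        rw [mem_pendants]
        by_contra hBn
        obtain ⟨B', hB', heB'⟩ := mem_hull_edges.1 he
        exact hB.1 ((hr.eq_of_destroyed heC he (mem_pendants.1 hB.2) hBn hB' heB').symm.trans
          (huniq B' hB' heB'))
    have hcard := Finset.card_le_card hsub
    rw [Finset.card_insert_of_notMem (fun h' => hCn (Finset.mem_of_mem_erase h')),
      Finset.card_erase_add_one (mem_pendants.2 hD)] at hcard
    cases hJ : F.oldestOpen h with
    | none => exact absurd (oldestOpen_eq_none.1 hJ D hD.1) (hh.pendant_open hF hR hM hlt heq hD)
    | some J =>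
      have hJh := mem_of_oldestOpen hJ
      have heJ : e ∈ J.edges := by simpa [anchor, hJ] using heA
      obtain rfl : J = D := huniq J hJh heJ
      obtain ⟨-, d, hd, hcut⟩ := hD
      have hopen : ¬ F.CopyClosed (hull (C :: h)) J := by
        refine not_copyClosed_of_touched hF hR hM hlt heq (hh.isCopyIn hJh)
          (hull_isSubgraph_cons C h) hd (IsPendant.edge_cut hcut) hC ?_ heJ heC ?_
        · intro f hf
          exact (Finset.mem_union.1 hf).symm
        · intro f hf
          rw [← hr.inter_eq heC he, Finset.inter_comm]
          exact Finset.inter_subset_inter_left ((hull h).edge_subset f hf)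
      have h0 : ¬ ∃ J', F.oldestOpen h = some J' ∧ ¬ IsPendant h J' := by
        rintro ⟨J', hJ', hp⟩
        rw [hJ, Option.some.injEq] at hJ'
        exact hp (hJ' ▸ ⟨hJh, d, hd, hcut⟩)
      have h1 : ∃ J', F.oldestOpen (C :: h) = some J' ∧ ¬ IsPendant (C :: h) J' :=
        ⟨J, oldestOpen_cons hJ hopen, hDn⟩
      unfold potential
      rw [if_neg h0, if_pos h1]
      omega

/-- A step decreases the potential by at most `2 * v(C) + 1`: distinct pendant members that cease to
be pendant are met by `C` in distinct vertices. -/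
theorem potential_le_add {h : List (LGraph ℓ V)} (C : LGraph ℓ V) :
    F.potential h ≤ F.potential (C :: h) + (2 * C.verts.card + 1) := by
  classical
  have hQ : (pendants h \ pendants (C :: h)).card ≤ C.verts.card := by
    have hx : ∀ D ∈ pendants h \ pendants (C :: h), ∃ x ∈ C.verts, x ∈ D.verts ∧
        ∀ B ∈ h, B ≠ D → x ∉ B.verts := by
      intro D hD
      rw [Finset.mem_sdiff, mem_pendants, mem_pendants] at hD
      obtain ⟨⟨hDh, d, hd, hcut⟩, hn⟩ := hD
      obtain ⟨x, hxC, hxD, hxd⟩ := IsPendant.exists_of_not_cons hDh hd hcut hn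
      exact ⟨x, hxC, hxD, fun B hB hBD hxB => hxd (hcut B hB hBD (Finset.mem_inter.2 ⟨hxB, hxD⟩))⟩
    rcases Finset.eq_empty_or_nonempty (pendants h \ pendants (C :: h)) with h0 | ⟨D₀, hD₀⟩
    · simp [h0]
    have : Nonempty V := ⟨(hx D₀ hD₀).choose⟩
    choose! x hxC hxD hx using hx
    refine Finset.card_le_card_of_injOn x hxC fun D hD D' hD' hDD => ?_
    by_contra hne
    have hDh : D ∈ h := (mem_pendants.1 (Finset.mem_sdiff.1 hD).1).1
    exact hx D' hD' D hDh hne (hDD ▸ hxD D hD)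
  have hP : (pendants h).card ≤ (pendants (C :: h)).card + C.verts.card :=
    (Finset.card_le_card_sdiff_add_card (t := pendants (C :: h))).trans (by omega)
  unfold potential
  split_ifs <;> omega

theorem IsHistory.regCount_le {h : List (LGraph ℓ V)} (hh : F.IsHistory h) (hF : F.IsTight R M)
    (hR : 0 < R) (hM : 2 ≤ M) (hlt : F.gamma + 1 < ℓ → 3 ≤ M) (heq : F.gamma + 1 = ℓ → R ≤ M) :
    regCount h ≤ F.potential h + 1 + (2 * (ℓ + R) + 1) * degCount h := by
  induction hh with
  | single C hC =>
    simp only [regCount]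
    split_ifs <;> omega
  | cons C h hh hC hnew ha ih =>
    by_cases hr : IsRegularStep C h
    · have := potential_add_one_le hh hF hR hM hlt heq hC hnew ha hr
      simp only [regCount, degCount, if_pos hr, add_zero]
      omega
    · have := potential_le_add (F := F) (h := h) C
      rw [(hC.isTight hF).card_verts] at this
      simp only [regCount, degCount, if_neg hr, add_zero, mul_add_one]
      omega

theorem IsHistory.potential_eq_zero {h : List (LGraph ℓ V)} (hh : F.IsHistory h)
    (hF : F.IsTight R M)
    (hR : 0 < R) (hM : 2 ≤ M) (hlt : F.gamma + 1 < ℓ → 3 ≤ M) (heq : F.gamma + 1 = ℓ → R ≤ M)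
    (hn : F.oldestOpen h = none) : F.potential h = 0 := by
  have : pendants h = ∅ := Finset.eq_empty_of_forall_notMem fun D hD =>
    hh.pendant_open hF hR hM hlt heq (mem_pendants.1 hD)
      (oldestOpen_eq_none.1 hn D (mem_pendants.1 hD).1)
  simp [potential, this, hn]

open Classical in
/-- After a regular step the new copy is pendant and hence open, so the next step is attached to an
open member. -/
theorem IsHistory.freeCount_le {h : List (LGraph ℓ V)} (hh : F.IsHistory h) (hF : F.IsTight R M)
    (hR : 0 < R) (hM : 2 ≤ M) (hlt : F.gamma + 1 < ℓ → 3 ≤ M) (heq : F.gamma + 1 = ℓ → R ≤ M) :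
    F.freeCount h + (if F.oldestOpen h = none then 1 else 0) ≤ degCount h + 2 := by
  induction hh with
  | single C hC =>
    simp only [freeCount, degCount]
    split_ifs <;> omega
  | cons C h hh hC hnew ha ih =>
    by_cases hr : IsRegularStep C h
    · obtain ⟨e, heC, heA⟩ := ha
      have hCp := hr.isPendant heC (anchor_subset h heA)
      have hne : F.oldestOpen (C :: h) ≠ none := fun h0 =>
        (IsHistory.cons C h hh hC hnew ⟨e, heC, heA⟩).pendant_open hF hR hM hlt heq hCp
          (oldestOpen_eq_none.1 h0 C hCp.1)
      simp only [freeCount, degCount, hr, true_and, if_true, if_neg hne]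
      split_ifs at ih ⊢ <;> omega
    · simp only [freeCount, degCount, hr, false_and, if_false]
      split_ifs at ih ⊢ <;> omega

end History

/-! ### Exploring a block -/

section Blocks

variable {ℓ : ℕ} {V W : Type*} [DecidableEq V] {F : LGraph ℓ W} {R M : ℕ} {B : LGraph ℓ V}

/-- In a block, an edge closed in `B` but not in the hull lies in a copy with a new edge, or is
separated from an edge equivalent to it in the hull by such a copy; otherwise the defining property
of a block, applied to the edges of the hull, yields the new copy. -/
theorem IsBlock.exists_extension (hB : F.IsBlock B) (hF : F.IsTight R M) (hR : 0 < R) (hM : 0 < M)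
    {h : List (LGraph ℓ V)} (hh : F.IsHistory h) (hhB : ∀ C ∈ h, F.IsCopyIn C B)
    (hne : (hull h).edges ≠ B.edges) :
    ∃ C, F.IsCopyIn C B ∧ F.IsHistory (C :: h) := by
  have hsub : (hull h).edges ⊆ B.edges := fun f hf => by
    obtain ⟨C, hC, hfC⟩ := mem_hull_edges.1 hf
    exact (hhB C hC).1.2 hfC
  suffices h' : ∃ C, F.IsCopyIn C B ∧ ¬ C.edges ⊆ (hull h).edges ∧ ∃ e ∈ C.edges, e ∈ F.anchor h by
    obtain ⟨C, hC, h1, h2⟩ := h'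
    exact ⟨C, hC, IsHistory.cons C h hh hC.2 h1 h2⟩
  cases hJ : F.oldestOpen h with
  | none =>
    have hanchor : F.anchor h = (hull h).edges := by simp [anchor, hJ]
    have hnonempty : (hull h).edges.Nonempty := by
      obtain ⟨C, hC⟩ : ∃ C, C ∈ h := by cases hh <;> exact ⟨_, List.mem_cons_self⟩
      have : C.edges.Nonempty := Finset.card_pos.1 (by
        rw [((hhB C hC).isTight hF).card_edges]; omega)
      exact this.mono (isSubgraph_hull hC).2
    obtain ⟨C, hC, ⟨e, heC, he⟩, e', heC', he'⟩ := hB.2 _ (hsub.ssubset_of_ne hne) hnonempty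
    exact ⟨C, hC, fun h' => he' (h' heC'), e, heC, hanchor ▸ he⟩
  | some J =>
    have hanchor : F.anchor h = J.edges := by simp [anchor, hJ]
    have hJh := mem_of_oldestOpen hJ
    have hJc := not_closed_of_oldestOpen hJ
    obtain ⟨T, hTJ, hT3, hT⟩ := hB.1.2.2 J (hhB J hJh)
    obtain ⟨e, heT, he⟩ : ∃ e ∈ T, ¬ F.EdgeClosed (hull h) e := by
      by_contra! hall
      exact hJc ⟨T, hTJ, hT3, hall⟩
    have heJ := hTJ heT
    have heH := (isSubgraph_hull hJh).2 heJ
    rw [hanchor]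
    by_contra! hcon
    -- every copy of `B` meeting `J` already lies in the hull
    have hin : ∀ A, F.IsCopyIn A B → ∀ f ∈ A.edges, f ∈ J.edges → F.IsCopyIn A (hull h) := by
      intro A hA f hfA hfJ
      refine isCopyIn_of_edges hF hR hM hA.2 ?_
      by_contra hAn
      exact hcon A hA hAn f hfA hfJ
    have htwo : F.InTwoCopies B e → F.InTwoCopies (hull h) e :=
      fun ⟨F₁, F₂, hne, h₁, h₂, he₁, he₂⟩ =>
        ⟨F₁, F₂, hne, hin F₁ h₁ e he₁ heJ, hin F₂ h₂ e he₂ heJ, he₁, he₂⟩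
    refine he ⟨heH, (hT e heT).2.imp (fun h' => ⟨h'.1, htwo h'.2⟩)
      fun h' => ⟨h'.1, htwo h'.2.1, fun e' he' hee heq => ?_⟩⟩
    have he'J : e' ∈ J.edges := (heq J (hh.isCopyIn hJh)).1 heJ
    refine h'.2.2 e' (hsub he') hee fun A hA => ⟨fun h1 => ?_, fun h1 => ?_⟩
    · exact (heq A (hin A hA e h1 heJ)).1 h1
    · exact (heq A (hin A hA e' h1 he'J)).2 h1

theorem card_hull_verts_le (hF : F.IsTight R M) {h : List (LGraph ℓ V)}
    (hh : ∀ C ∈ h, F.IsIsomorphic C) : (hull h).verts.card ≤ (ℓ + R) * h.length := by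
  induction h with
  | nil => simp [hull]
  | cons C h ih =>
    have h1 := ih fun D hD => hh D (List.mem_cons_of_mem _ hD)
    have h2 := ((hh C List.mem_cons_self).isTight hF).card_verts
    have h3 := Finset.card_union_le C.verts (hull h).verts
    simp only [hull, List.length_cons, mul_add, mul_one]
    omega

/-- A block either is small or contains a history that is long or has many degenerate steps. -/
theorem IsBlock.card_verts_le_or (hB : F.IsBlock B) (hF : F.IsTight R M)
    (hR : 0 < R) (hM : 2 ≤ M) (hlt : F.gamma + 1 < ℓ → 3 ≤ M) (heq : F.gamma + 1 = ℓ → R ≤ M)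
    (K N : ℕ) (hN : 0 < N) :
    B.verts.card ≤ (ℓ + R) * (1 + (2 * (ℓ + R) + 2) * K) ∨
      ∃ h : List (LGraph ℓ V), F.IsHistory h ∧ (hull h).edges ⊆ B.edges ∧ h.length ≤ N ∧
        (h.length = N ∨ K ≤ degCount h) := by
  rcases B.verts.eq_empty_or_nonempty with h0 | ⟨x, hx⟩
  · left; simp [h0]
  obtain ⟨C₀, hC₀, -⟩ := hB.1.1 x hx
  -- A longest history of length at most `N` in `B` has hull `B`, unless it is long or degenerate.
  let P : ℕ → Prop := fun k => ∃ h : List (LGraph ℓ V), F.IsHistory h ∧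
    (∀ C ∈ h, F.IsCopyIn C B) ∧ h.length = k
  have hP1 : P 1 := ⟨[C₀], IsHistory.single C₀ hC₀.2, by simpa using hC₀, rfl⟩
  classical
  obtain ⟨h, hh, hhB, hlen⟩ := Nat.findGreatest_spec (P := P) hN hP1
  have hlenN : h.length ≤ N := hlen ▸ Nat.findGreatest_le N
  have hsub : (hull h).edges ⊆ B.edges := fun f hf => by
    obtain ⟨C, hC, hfC⟩ := mem_hull_edges.1 hf
    exact (hhB C hC).1.2 hfC
  by_cases hbad : h.length = N ∨ K ≤ degCount h
  · exact Or.inr ⟨h, hh, hsub, hlenN, hbad⟩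
  left
  push Not at hbad
  have hfull : (hull h).edges = B.edges := by
    by_contra hne
    obtain ⟨C, hC, hCh⟩ := hB.exists_extension hF hR (by omega) hh hhB hne
    have : P (h.length + 1) := ⟨C :: h, hCh, by
      intro D hD
      rcases List.mem_cons.1 hD with rfl | hD
      · exact hC
      · exact hhB D hD, rfl⟩
    have := Nat.le_findGreatest (P := P) (n := N) (by omega) this
    omega
  have hBsub : B.IsSubgraph (hull h) := by
    refine ⟨fun y hy => ?_, hfull.ge⟩
    obtain ⟨A, hA, hyA⟩ := hB.1.1 y hy
    exact (hA.isTight hF).verts_subset_of_edges hR (by omega) (hA.1.2.trans hfull.ge) hyA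
  have hnone : F.oldestOpen h = none := oldestOpen_eq_none.2 fun C hC =>
    (hB.1.2.2 C (hhB C hC)).mono hBsub
  have h1 := hh.regCount_le hF hR hM hlt heq
  rw [hh.potential_eq_zero hF hR hM hlt heq hnone] at h1
  have h2 := regCount_add_degCount h
  have h3 := card_hull_verts_le hF fun C hC => (hhB C hC).2
  refine (Finset.card_le_card hBsub.1).trans (h3.trans (Nat.mul_le_mul_left _ ?_))
  have h4 : (2 * (ℓ + R) + 2) * degCount h ≤ (2 * (ℓ + R) + 2) * K :=
    Nat.mul_le_mul_left _ hbad.2.le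
  have h5 : (2 * (ℓ + R) + 2) * degCount h = (2 * (ℓ + R) + 1) * degCount h + degCount h := by ring
  omega

end Blocks


/-! ### Counting graphs on a finite vertex set -/

section Counting

variable {ℓ : ℕ} {V : Type*}

noncomputable instance instFintypeLGraph [DecidableEq V] [Fintype V] : Fintype (LGraph ℓ V) :=
  Fintype.ofInjective (fun G : LGraph ℓ V => (G.verts, G.edges)) fun _ _ h =>
    LGraph.ext (congrArg Prod.fst h) (congrArg Prod.snd h)

/-- A bound for the number of hypergraphs on a given set of `v` vertices. -/
def shapeCount (v : ℕ) : ℕ := 2 ^ 2 ^ v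

theorem shapeCount_pos (v : ℕ) : 0 < shapeCount v := by unfold shapeCount; positivity

theorem sum_verts_le [DecidableEq V] (S : Finset (LGraph ℓ V)) (P : Finset (Finset V)) (v : ℕ)
    (hP : ∀ C ∈ S, C.verts ∈ P) (hv : ∀ U ∈ P, U.card = v) (u : Finset V → ℝ)
    (hu : ∀ U, 0 ≤ u U) :
    ∑ C ∈ S, u C.verts ≤ shapeCount v * ∑ U ∈ P, u U := by
  classical
  rw [← Finset.sum_fiberwise_of_maps_to hP, Finset.mul_sum]
  refine Finset.sum_le_sum fun U hU => ?_
  have h1 : ∑ C ∈ S.filter (fun C => C.verts = U), u C.verts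
      = (S.filter (fun C => C.verts = U)).card * u U := by
    rw [Finset.sum_congr rfl (g := fun _ => u U), Finset.sum_const, nsmul_eq_mul]
    intro C hC
    rw [(Finset.mem_filter.1 hC).2]
  rw [h1]
  refine mul_le_mul_of_nonneg_right ?_ (hu U)
  have h2 : (S.filter (fun C => C.verts = U)).card ≤ U.powerset.powerset.card := by
    refine Finset.card_le_card_of_injOn LGraph.edges ?_ ?_
    · intro C hC
      have hC' := (Finset.mem_filter.1 hC).2
      simp only [Finset.coe_powerset, Set.mem_preimage, Set.mem_powerset_iff]
      intro f hf
      simpa [hC'] using C.edge_subset f hf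
    · intro C hC D hD h
      exact LGraph.ext ((Finset.mem_filter.1 hC).2.trans (Finset.mem_filter.1 hD).2.symm) h
  rw [Finset.card_powerset, Finset.card_powerset, hv U hU] at h2
  exact_mod_cast h2

/-- An elementary symmetric function of nonnegative numbers is at most the corresponding power of
their sum. -/
theorem sum_powersetCard_prod_le [DecidableEq V] [Fintype V] (w : V → ℝ)
    (hw : ∀ x, 0 ≤ w x) (k : ℕ) :
    ∑ U ∈ Finset.powersetCard k (Finset.univ : Finset V), ∏ x ∈ U, w x ≤ (∑ x, w x) ^ k := by
  classical
  have key : ∀ U ∈ Finset.powersetCard k (Finset.univ : Finset V),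
      ∃ f : Fin k → V, Finset.univ.image f = U ∧ Function.Injective f := by
    intro U hU
    have hc := (Finset.mem_powersetCard.1 hU).2
    let φ := (U.equivFinOfCardEq hc).symm
    refine ⟨fun i => (φ i : V), ?_, fun i j hij => φ.injective (Subtype.ext hij)⟩
    ext x
    simp only [Finset.mem_image, Finset.mem_univ, true_and]
    constructor
    · rintro ⟨i, rfl⟩; exact (φ i).2
    · intro hx; exact ⟨φ.symm ⟨x, hx⟩, by simp⟩
  rcases isEmpty_or_nonempty (Fin k → V) with hE | hE
  · rw [Finset.sum_eq_zero fun U hU => (hE.false (key U hU).choose).elim]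
    exact pow_nonneg (Finset.sum_nonneg fun x _ => hw x) k
  choose! f hf hinj using key
  have h1 : (∑ x, w x) ^ k = ∑ g : Fin k → V, ∏ i, w (g i) := by
    rw [← Fintype.piFinset_univ, ← Finset.prod_univ_sum]
    simp
  rw [h1]
  calc ∑ U ∈ Finset.powersetCard k (Finset.univ : Finset V), ∏ x ∈ U, w x
      = ∑ U ∈ Finset.powersetCard k (Finset.univ : Finset V), ∏ i, w (f U i) := by
        refine Finset.sum_congr rfl fun U hU => ?_
        conv_lhs => rw [← hf U hU]
        rw [Finset.prod_image fun a _ b _ h => hinj U hU h]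
    _ = ∑ g ∈ (Finset.powersetCard k (Finset.univ : Finset V)).image f, ∏ i, w (g i) := by
        rw [Finset.sum_image]
        intro U hU U' hU' h
        rw [← hf U hU, ← hf U' hU', h]
    _ ≤ ∑ g : Fin k → V, ∏ i, w (g i) :=
        Finset.sum_le_sum_of_subset_of_nonneg (Finset.subset_univ _) fun g _ _ =>
          Finset.prod_nonneg fun i _ => hw _

theorem card_supersets_le [DecidableEq V] [Fintype V] (e : Finset V) (R : ℕ) (he : e.card = ℓ) :
    ((Finset.powersetCard (ℓ + R) (Finset.univ : Finset V)).filter (e ⊆ ·)).card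
      ≤ Fintype.card V ^ R := by
  have h1 : ((Finset.powersetCard (ℓ + R) (Finset.univ : Finset V)).filter (e ⊆ ·)).card
      ≤ (Finset.powersetCard R (Finset.univ : Finset V)).card := by
    refine Finset.card_le_card_of_injOn (· \ e) ?_ ?_
    · intro U hU
      simp only [Finset.coe_filter, Finset.mem_powersetCard, Set.mem_ofPred_eq] at hU
      have := Finset.card_sdiff_add_card_eq_card hU.2
      exact Finset.mem_coe.2 (Finset.mem_powersetCard.2 ⟨Finset.subset_univ _,
        show (U \ e).card = R by omega⟩)
    · intro U hU U' hU' h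
      simp only [Finset.coe_filter, Set.mem_ofPred_eq] at hU hU'
      simp only at h
      rw [← Finset.sdiff_union_of_subset hU.2, h, Finset.sdiff_union_of_subset hU'.2]
  rw [Finset.card_powersetCard, Finset.card_univ] at h1
  exact h1.trans (Nat.choose_le_pow _ _)

end Counting


/-! ### The expected number of continuations of a history -/

section Steps

variable {ℓ : ℕ} {V W : Type*} [DecidableEq V] {F : LGraph ℓ W} {R M : ℕ}

theorem IsRegularStep.card_new {C : LGraph ℓ V} {h : List (LGraph ℓ V)} (hC : C.IsTight R M)
    (hr : IsRegularStep C h) {e : Finset V} (heC : e ∈ C.edges) (he : e ∈ (hull h).edges) :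
    (C.edges \ (hull h).edges).card = M := by
  have : C.edges \ (hull h).edges = C.edges.erase e := by
    ext f
    simp only [Finset.mem_sdiff, Finset.mem_erase]
    constructor
    · rintro ⟨h1, h2⟩
      exact ⟨fun h' => h2 (h' ▸ he), h1⟩
    · rintro ⟨h1, h2⟩
      refine ⟨h2, fun h3 => h1 ?_⟩
      have hsub : f ⊆ e := by
        rw [← hr.inter_eq heC he]
        exact Finset.subset_inter (C.edge_subset f h2) ((hull h).edge_subset f h3)
      exact Finset.eq_of_subset_of_card_le hsub (by rw [C.edge_card e heC, C.edge_card f h2])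
  rw [this, Finset.card_erase_of_mem heC, hC.card_edges]
  rfl

/-- The gain of a degenerate step: the number of new edges, weighted by `R`, exceeds the number of
new vertices, weighted by `M`. -/
theorem degenerate_exponent {C : LGraph ℓ V} {h : List (LGraph ℓ V)} (hC : C.IsTight R M)
    (hr : ¬ IsRegularStep C h) (hnew : ¬ C.edges ⊆ (hull h).edges) :
    M * (C.verts \ (hull h).verts).card + 1 ≤ R * (C.edges \ (hull h).edges).card := by
  have h1 := hC.strict (C.verts ∩ (hull h).verts) (C.edges ∩ (hull h).edges)
    Finset.inter_subset_left Finset.inter_subset_left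
    (fun f hf => by
      rw [Finset.mem_inter] at hf
      exact Finset.subset_inter (C.edge_subset f hf.1) ((hull h).edge_subset f hf.2))
    (not_le.1 hr) (Or.inr fun h' => hnew (Finset.inter_eq_left.1 h'))
  have h2 := Finset.card_sdiff_add_card_inter C.verts (hull h).verts
  have h3 := Finset.card_sdiff_add_card_inter C.edges (hull h).edges
  rw [hC.card_verts] at h2
  rw [hC.card_edges] at h3
  have e1 : M * (C.verts \ (hull h).verts).card + M * (C.verts ∩ (hull h).verts).card
      = M * ℓ + R * M := by rw [← mul_add, h2]; ring
  have e2 : R * (C.edges \ (hull h).edges).card + R * (C.edges ∩ (hull h).edges).card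
      = R * M + R := by rw [← mul_add, h3]; ring
  omega

theorem card_anchor_of_some (hF : F.IsTight R M) {h : List (LGraph ℓ V)} (hh : F.IsHistory h)
    (hJ : F.oldestOpen h ≠ none) : (F.anchor h).card = M + 1 := by
  obtain ⟨J, hJ⟩ := Option.ne_none_iff_exists'.1 hJ
  simp only [anchor, hJ]
  exact ((hh.isIsomorphic (mem_of_oldestOpen hJ)).isTight hF).card_edges

theorem card_hull_edges_le (hF : F.IsTight R M) {h : List (LGraph ℓ V)}
    (hh : ∀ C ∈ h, F.IsIsomorphic C) : (hull h).edges.card ≤ (M + 1) * h.length := by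
  induction h with
  | nil => simp [hull]
  | cons C h ih =>
    have h1 := ih fun D hD => hh D (List.mem_cons_of_mem _ hD)
    have h2 := ((hh C List.mem_cons_self).isTight hF).card_edges
    have h3 := Finset.card_union_le C.edges (hull h).edges
    simp only [hull, List.length_cons, mul_add, mul_one] at *
    omega

open Classical in
/-- The factor that the attachment of `C` to `h` contributes to the weight, besides the probability
of its new edges. It rewards degenerate steps and regular steps at an open member, and it absorbs the
number of choices of an edge in a step at an arbitrary edge of the hull. -/
noncomputable def stepFactor (F : LGraph ℓ W) (z : ℝ) (C : LGraph ℓ V)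
    (h : List (LGraph ℓ V)) : ℝ :=
  if IsRegularStep C h then (if F.oldestOpen h = none then z⁻¹ else 2) else z ^ 2

variable [Fintype V]

open Classical in
variable (F) in
/-- The copies by which the history `h` can be continued. -/
noncomputable def nextCopies (h : List (LGraph ℓ V)) : Finset (LGraph ℓ V) :=
  Finset.univ.filter fun C => F.IsIsomorphic C ∧ ¬ C.edges ⊆ (hull h).edges ∧
    ∃ e ∈ C.edges, e ∈ F.anchor h

theorem mem_nextCopies {h : List (LGraph ℓ V)} {C : LGraph ℓ V} :
    C ∈ F.nextCopies h ↔ F.IsIsomorphic C ∧ ¬ C.edges ⊆ (hull h).edges ∧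
      ∃ e ∈ C.edges, e ∈ F.anchor h := by
  simp [nextCopies]

open Classical in
theorem card_copies_le (hF : F.IsTight R M) :
    (Finset.univ.filter fun C : LGraph ℓ V => F.IsIsomorphic C).card ≤
      shapeCount (ℓ + R) * Fintype.card V ^ (ℓ + R) := by
  have h := sum_verts_le (Finset.univ.filter fun C : LGraph ℓ V => F.IsIsomorphic C)
    (Finset.powersetCard (ℓ + R) Finset.univ) (ℓ + R)
    (fun C hC => Finset.mem_powersetCard.2 ⟨Finset.subset_univ _,
      ((Finset.mem_filter.1 hC).2.isTight hF).card_verts⟩)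
    (fun U hU => (Finset.mem_powersetCard.1 hU).2) (fun _ => 1) (fun _ => zero_le_one)
  simp only [Finset.sum_const, nsmul_eq_mul, mul_one, Finset.card_powersetCard,
    Finset.card_univ] at h
  have h' : (Finset.univ.filter fun C : LGraph ℓ V => F.IsIsomorphic C).card ≤
      shapeCount (ℓ + R) * (Fintype.card V).choose (ℓ + R) := by exact_mod_cast h
  exact h'.trans (Nat.mul_le_mul_left _ (Nat.choose_le_pow _ _))

open Classical in
theorem card_copies_containing_le (hF : F.IsTight R M) (e : Finset V) (he : e.card = ℓ) :
    (Finset.univ.filter fun C : LGraph ℓ V => F.IsIsomorphic C ∧ e ⊆ C.verts).card ≤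
      shapeCount (ℓ + R) * Fintype.card V ^ R := by
  have h := sum_verts_le
    (Finset.univ.filter fun C : LGraph ℓ V => F.IsIsomorphic C ∧ e ⊆ C.verts)
    ((Finset.powersetCard (ℓ + R) Finset.univ).filter (e ⊆ ·)) (ℓ + R)
    (fun C hC => by
      obtain ⟨h1, h2⟩ := (Finset.mem_filter.1 hC).2
      exact Finset.mem_filter.2 ⟨Finset.mem_powersetCard.2 ⟨Finset.subset_univ _,
        (h1.isTight hF).card_verts⟩, h2⟩)
    (fun U hU => (Finset.mem_powersetCard.1 (Finset.mem_filter.1 hU).1).2)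
    (fun _ => 1) (fun _ => zero_le_one)
  simp only [Finset.sum_const, nsmul_eq_mul, mul_one] at h
  have h' : (Finset.univ.filter fun C : LGraph ℓ V => F.IsIsomorphic C ∧ e ⊆ C.verts).card ≤
      shapeCount (ℓ + R) * ((Finset.powersetCard (ℓ + R) Finset.univ).filter (e ⊆ ·)).card := by
    exact_mod_cast h
  exact h'.trans (Nat.mul_le_mul_left _ (card_supersets_le e R he))

open Classical in
/-- The expected number of regular continuations. -/
theorem sum_regular_le (hF : F.IsTight R M) (hM : 0 < M) (h : List (LGraph ℓ V)) {p z c : ℝ}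
    (hp : 0 ≤ p) (hz : 0 ≤ z) (hc1 : c ≤ 1) (hpz : p * z ^ (4 * R) ≤ c)
    (hn : (Fintype.card V : ℝ) = z ^ (4 * M)) :
    ∑ C ∈ (F.nextCopies h).filter (IsRegularStep · h), p ^ (C.edges \ (hull h).edges).card ≤
      (F.anchor h).card * (shapeCount (ℓ + R) * c) := by
  have hterm : ∀ C ∈ (F.nextCopies h).filter (IsRegularStep · h),
      p ^ (C.edges \ (hull h).edges).card = p ^ M := by
    intro C hC
    obtain ⟨hC, hr⟩ := Finset.mem_filter.1 hC
    obtain ⟨hi, -, e, heC, heA⟩ := mem_nextCopies.1 hC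
    rw [hr.card_new (hi.isTight hF) heC (anchor_subset h heA)]
  rw [Finset.sum_congr rfl hterm, Finset.sum_const, nsmul_eq_mul]
  have hsub : (F.nextCopies h).filter (IsRegularStep · h) ⊆ (F.anchor h).biUnion fun e =>
      Finset.univ.filter fun C : LGraph ℓ V => F.IsIsomorphic C ∧ e ⊆ C.verts := by
    intro C hC
    obtain ⟨hi, -, e, heC, heA⟩ := mem_nextCopies.1 (Finset.mem_filter.1 hC).1
    exact Finset.mem_biUnion.2 ⟨e, heA, by simp [hi, C.edge_subset e heC]⟩
  have hcard : ((F.nextCopies h).filter (IsRegularStep · h)).card ≤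
      (F.anchor h).card * (shapeCount (ℓ + R) * Fintype.card V ^ R) :=
    (Finset.card_le_card hsub).trans (Finset.card_biUnion_le_card_mul _ _ _ fun e he =>
      card_copies_containing_le hF e ((hull h).edge_card e (anchor_subset h he)))
  have hcard' : (((F.nextCopies h).filter (IsRegularStep · h)).card : ℝ) ≤
      (F.anchor h).card * (shapeCount (ℓ + R) * (Fintype.card V : ℝ) ^ R) := by
    exact_mod_cast hcard
  have hpc : (Fintype.card V : ℝ) ^ R * p ^ M ≤ c := by
    rw [hn]
    calc (z ^ (4 * M)) ^ R * p ^ M = (p * z ^ (4 * R)) ^ M := by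
          rw [mul_pow, ← pow_mul, ← pow_mul]; ring
      _ ≤ (p * z ^ (4 * R)) ^ 1 :=
          pow_le_pow_of_le_one (by positivity) (hpz.trans hc1) hM
      _ ≤ c := by rwa [pow_one]
  calc (((F.nextCopies h).filter (IsRegularStep · h)).card : ℝ) * p ^ M
      ≤ (F.anchor h).card * (shapeCount (ℓ + R) * (Fintype.card V : ℝ) ^ R) * p ^ M :=
        mul_le_mul_of_nonneg_right hcard' (by positivity)
    _ = (F.anchor h).card * (shapeCount (ℓ + R) * ((Fintype.card V : ℝ) ^ R * p ^ M)) := by ring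
    _ ≤ _ := by gcongr

open Classical in
/-- The expected number of degenerate continuations. Each vertex of a new copy gets weight `1` in
the hull and `1 / n` outside. -/
theorem sum_degenerate_le (hF : F.IsTight R M) (h : List (LGraph ℓ V)) {p z : ℝ}
    (hp : 0 ≤ p) (hz : 1 ≤ z) (hpz : p * z ^ (4 * R) ≤ 1)
    (hn : (Fintype.card V : ℝ) = z ^ (4 * M)) :
    ∑ C ∈ (F.nextCopies h).filter (¬ IsRegularStep · h), p ^ (C.edges \ (hull h).edges).card ≤
      z⁻¹ ^ 4 * (shapeCount (ℓ + R) * ((hull h).verts.card + 1 : ℝ) ^ (ℓ + R)) := by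
  have hz0 : 0 < z := by linarith
  set w : V → ℝ := fun x => if x ∈ (hull h).verts then 1 else z⁻¹ ^ (4 * M) with hw
  have hw0 : ∀ x, 0 ≤ w x := fun x => by
    simp only [hw]; split_ifs <;> positivity
  have hpz' : p ≤ z⁻¹ ^ (4 * R) := by
    rw [inv_pow, ← one_div, le_div_iff₀ (by positivity)]; exact hpz
  have hzi : z⁻¹ ≤ 1 := inv_le_one_of_one_le₀ hz
  have hterm : ∀ C ∈ (F.nextCopies h).filter (¬ IsRegularStep · h),
      p ^ (C.edges \ (hull h).edges).card ≤ z⁻¹ ^ 4 * ∏ x ∈ C.verts, w x := by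
    intro C hC
    obtain ⟨hC, hr⟩ := Finset.mem_filter.1 hC
    obtain ⟨hi, hnew, -⟩ := mem_nextCopies.1 hC
    have hexp := degenerate_exponent (hi.isTight hF) hr hnew
    have hprod : ∏ x ∈ C.verts, w x = z⁻¹ ^ (4 * M * (C.verts \ (hull h).verts).card) := by
      rw [Finset.prod_ite, Finset.prod_const_one, one_mul, Finset.prod_const, ← pow_mul,
        Finset.filter_notMem_eq_sdiff]
    rw [hprod, ← pow_add]
    calc p ^ (C.edges \ (hull h).edges).card
        ≤ (z⁻¹ ^ (4 * R)) ^ (C.edges \ (hull h).edges).card := by gcongr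
      _ = z⁻¹ ^ (4 * (R * (C.edges \ (hull h).edges).card)) := by rw [← pow_mul, mul_assoc]
      _ ≤ _ := pow_le_pow_of_le_one (by positivity) hzi (by rw [mul_assoc]; omega)
  have hsumw : ∑ x, w x ≤ (hull h).verts.card + 1 := by
    rw [Finset.sum_ite]
    simp only [Finset.sum_const, nsmul_eq_mul, mul_one]
    have h1 : (Finset.univ.filter (· ∈ (hull h).verts)) = (hull h).verts := by ext; simp
    rw [h1]
    have h2 : ((Finset.univ.filter (· ∉ (hull h).verts)).card : ℝ) ≤ z ^ (4 * M) := by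
      rw [← hn]; exact_mod_cast Finset.card_le_univ _
    have h3 : z ^ (4 * M) * z⁻¹ ^ (4 * M) = 1 := by
      rw [← mul_pow, mul_inv_cancel₀ hz0.ne', one_pow]
    have h4 := mul_le_mul_of_nonneg_right h2 (show 0 ≤ z⁻¹ ^ (4 * M) by positivity)
    linarith
  calc ∑ C ∈ (F.nextCopies h).filter (¬ IsRegularStep · h), p ^ (C.edges \ (hull h).edges).card
      ≤ ∑ C ∈ (F.nextCopies h).filter (¬ IsRegularStep · h), z⁻¹ ^ 4 * ∏ x ∈ C.verts, w x :=
        Finset.sum_le_sum hterm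
    _ = z⁻¹ ^ 4 * ∑ C ∈ (F.nextCopies h).filter (¬ IsRegularStep · h), ∏ x ∈ C.verts, w x := by
        rw [Finset.mul_sum]
    _ ≤ z⁻¹ ^ 4 * (shapeCount (ℓ + R) *
          ∑ U ∈ Finset.powersetCard (ℓ + R) (Finset.univ : Finset V), ∏ x ∈ U, w x) := by
        refine mul_le_mul_of_nonneg_left ?_ (by positivity)
        refine sum_verts_le _ _ (ℓ + R) (fun C hC => ?_)
          (fun U hU => (Finset.mem_powersetCard.1 hU).2) (fun U => ∏ x ∈ U, w x)
          (fun U => Finset.prod_nonneg fun x _ => hw0 x)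
        exact Finset.mem_powersetCard.2 ⟨Finset.subset_univ _,
          ((mem_nextCopies.1 (Finset.mem_filter.1 hC).1).1.isTight hF).card_verts⟩
    _ ≤ z⁻¹ ^ 4 * (shapeCount (ℓ + R) * (∑ x, w x) ^ (ℓ + R)) := by
        gcongr
        exact sum_powersetCard_prod_le w hw0 _
    _ ≤ _ := by
        have : 0 ≤ ∑ x, w x := Finset.sum_nonneg fun x _ => hw0 x
        gcongr

/-- The weight of a history is at least the total weight of its continuations. -/
theorem sum_step_le (hF : F.IsTight R M) (hM : 0 < M) {h : List (LGraph ℓ V)} (hh : F.IsHistory h)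
    {p z c : ℝ} {N : ℕ} (hp : 0 ≤ p) (hz : 1 ≤ z) (hc1 : c ≤ 1)
    (hc : 4 * ((M + 1 : ℝ) * (shapeCount (ℓ + R) * c)) ≤ 1)
    (hpz : p * z ^ (4 * R) ≤ c) (hn : (Fintype.card V : ℝ) = z ^ (4 * M)) (hlen : h.length ≤ N)
    (hN : 2 * (shapeCount (ℓ + R) * ((ℓ + R : ℝ) * N + 1) ^ (ℓ + R)) ≤ z) (hNz : N ≤ z) :
    ∑ C ∈ F.nextCopies h, p ^ (C.edges \ (hull h).edges).card * F.stepFactor z C h ≤ 1 := by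
  classical
  have hz0 : 0 < z := by linarith
  have hc0 : 0 ≤ c := le_trans (by positivity) hpz
  have hs : (0 : ℝ) < shapeCount (ℓ + R) := by exact_mod_cast shapeCount_pos _
  rw [← Finset.sum_filter_add_sum_filter_not (F.nextCopies h) (IsRegularStep · h)]
  have hreg : ∑ C ∈ (F.nextCopies h).filter (IsRegularStep · h),
      p ^ (C.edges \ (hull h).edges).card * F.stepFactor z C h ≤ 1 / 2 := by
    have e1 : ∀ C ∈ (F.nextCopies h).filter (IsRegularStep · h),
        p ^ (C.edges \ (hull h).edges).card * F.stepFactor z C h =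
        p ^ (C.edges \ (hull h).edges).card * (if F.oldestOpen h = none then z⁻¹ else 2) := by
      intro C hC
      rw [stepFactor, if_pos (Finset.mem_filter.1 hC).2]
    rw [Finset.sum_congr rfl e1, ← Finset.sum_mul]
    have hsum := sum_regular_le hF hM h hp hz0.le hc1 hpz hn
    by_cases hJ : F.oldestOpen h = none
    · rw [if_pos hJ]
      have ha : ((F.anchor h).card : ℝ) ≤ (M + 1) * z := by
        have h1 : (F.anchor h).card ≤ (M + 1) * h.length :=
          (Finset.card_le_card (anchor_subset h)).trans
            (card_hull_edges_le hF fun C hC => hh.isIsomorphic hC)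
        have h2 : ((F.anchor h).card : ℝ) ≤ (M + 1) * h.length := by exact_mod_cast h1
        refine h2.trans (mul_le_mul_of_nonneg_left ?_ (by positivity))
        exact le_trans (by exact_mod_cast hlen) hNz
      calc _ ≤ ((F.anchor h).card * (shapeCount (ℓ + R) * c)) * z⁻¹ :=
            mul_le_mul_of_nonneg_right hsum (by positivity)
        _ ≤ ((M + 1) * z * (shapeCount (ℓ + R) * c)) * z⁻¹ := by gcongr
        _ = (M + 1) * (shapeCount (ℓ + R) * c) := by field_simp
        _ ≤ 1 / 2 := by linarith
    · rw [if_neg hJ]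
      rw [card_anchor_of_some hF hh hJ] at hsum
      push_cast at hsum
      linarith
  have hdeg : ∑ C ∈ (F.nextCopies h).filter (¬ IsRegularStep · h),
      p ^ (C.edges \ (hull h).edges).card * F.stepFactor z C h ≤ 1 / 2 := by
    have e1 : ∀ C ∈ (F.nextCopies h).filter (¬ IsRegularStep · h),
        p ^ (C.edges \ (hull h).edges).card * F.stepFactor z C h =
        p ^ (C.edges \ (hull h).edges).card * z ^ 2 := by
      intro C hC
      rw [stepFactor, if_neg (Finset.mem_filter.1 hC).2]
    rw [Finset.sum_congr rfl e1, ← Finset.sum_mul]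
    have hsum := sum_degenerate_le hF h hp hz (hpz.trans hc1) hn
    have hv : ((hull h).verts.card : ℝ) ≤ (ℓ + R) * N := by
      have h1 := (card_hull_verts_le hF fun C hC => hh.isIsomorphic hC).trans
        (Nat.mul_le_mul_left (ℓ + R) hlen)
      exact_mod_cast h1
    have hzi : z⁻¹ ≤ 1 := inv_le_one_of_one_le₀ hz
    calc _ ≤ (z⁻¹ ^ 4 * (shapeCount (ℓ + R) * ((hull h).verts.card + 1 : ℝ) ^ (ℓ + R))) * z ^ 2 :=
          mul_le_mul_of_nonneg_right hsum (by positivity)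
      _ ≤ (z⁻¹ ^ 4 * (shapeCount (ℓ + R) * ((ℓ + R : ℝ) * N + 1) ^ (ℓ + R))) * z ^ 2 := by gcongr
      _ = z⁻¹ ^ 2 * (shapeCount (ℓ + R) * ((ℓ + R : ℝ) * N + 1) ^ (ℓ + R)) := by field_simp
      _ ≤ z⁻¹ ^ 2 * (z / 2) := by gcongr; linarith
      _ = z⁻¹ / 2 := by field_simp
      _ ≤ 1 / 2 := by linarith
  linarith

end Steps


/-! ### Weights and bad histories -/

section Weight

variable {ℓ : ℕ} {V W : Type*} [DecidableEq V] {F : LGraph ℓ W} {R M : ℕ}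

/-- The probability of the hull of a history, multiplied by the factors of its steps. -/
noncomputable def weight (F : LGraph ℓ W) (p z : ℝ) (h : List (LGraph ℓ V)) : ℝ :=
  p ^ (hull h).edges.card * (2 ^ F.boundCount h * (z ^ 2) ^ degCount h * z⁻¹ ^ F.freeCount h)

theorem weight_cons (p z : ℝ) (C : LGraph ℓ V) (h : List (LGraph ℓ V)) :
    F.weight p z (C :: h) =
      F.weight p z h * (p ^ (C.edges \ (hull h).edges).card * F.stepFactor z C h) := by
  have hcard : (hull (C :: h)).edges.card =
      (hull h).edges.card + (C.edges \ (hull h).edges).card := by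
    have : (hull (C :: h)).edges = (hull h).edges ∪ (C.edges \ (hull h).edges) := by
      rw [Finset.union_sdiff_self_eq_union, Finset.union_comm]; rfl
    rw [this, Finset.card_union_of_disjoint Finset.disjoint_sdiff]
  simp only [weight, hcard, pow_add, stepFactor, boundCount, degCount, freeCount]
  by_cases h1 : IsRegularStep C h <;> by_cases h2 : F.oldestOpen h = none <;>
    simp [h1, h2] <;> ring

theorem weight_nonneg {p z : ℝ} (hp : 0 ≤ p) (hz : 0 ≤ z) (h : List (LGraph ℓ V)) :
    0 ≤ F.weight p z h := by
  unfold weight; positivity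

/-- The weight of a history of full length or with many degenerate steps exceeds its probability by
the factor `z ^ T`. -/
theorem IsHistory.pow_mul_le_weight {h : List (LGraph ℓ V)} (hh : F.IsHistory h)
    (hF : F.IsTight R M)
    (hR : 0 < R) (hM : 2 ≤ M) (hlt : F.gamma + 1 < ℓ → 3 ≤ M) (heq : F.gamma + 1 = ℓ → R ≤ M)
    {p z : ℝ} (hp : 0 ≤ p) (hz : 1 ≤ z) {T N : ℕ}
    (hN : z ^ (T + 2) ≤ 2 ^ (N - (2 * (T + 2) + 2)))
    (hbad : h.length = N ∨ T + 2 ≤ degCount h) :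
    p ^ (hull h).edges.card * z ^ T ≤ F.weight p z h := by
  have hz0 : 0 < z := by linarith
  unfold weight
  refine mul_le_mul_of_nonneg_left ?_ (by positivity)
  have h1 := hh.freeCount_le hF hR hM hlt heq
  have h2 : F.freeCount h ≤ degCount h + 2 := by omega
  have h3 := regCount_add_degCount h
  have h4 := boundCount_add_freeCount (F := F) h
  set b := F.boundCount h
  set d := degCount h
  set f := F.freeCount h
  have e1 : z ^ (T + f) ≤ 2 ^ b * (z ^ 2) ^ d := by
    by_cases hd : T + 2 ≤ d
    · calc z ^ (T + f) ≤ z ^ (2 * d) := pow_le_pow_right₀ hz (by omega)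
        _ = 1 * (z ^ 2) ^ d := by rw [one_mul, pow_mul]
        _ ≤ 2 ^ b * (z ^ 2) ^ d := by
          gcongr
          exact one_le_pow₀ (by norm_num)
    · have hb : N - (2 * (T + 2) + 2) ≤ b := by omega
      calc z ^ (T + f) ≤ z ^ (T + 2) * z ^ (2 * d) := by
            rw [← pow_add]; exact pow_le_pow_right₀ hz (by omega)
        _ ≤ 2 ^ b * (z ^ 2) ^ d := by
          rw [← pow_mul]
          refine mul_le_mul_of_nonneg_right (hN.trans ?_) (by positivity)
          exact pow_le_pow_right₀ (by norm_num) hb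
  calc z ^ T = z ^ (T + f) * z⁻¹ ^ f := by
        rw [pow_add, mul_assoc, ← mul_pow, mul_inv_cancel₀ hz0.ne', one_pow, mul_one]
    _ ≤ _ := mul_le_mul_of_nonneg_right e1 (by positivity)

variable [Fintype V]

open Classical in
/-- The histories of length `k + 1` on a finite vertex set. -/
noncomputable def histories (F : LGraph ℓ W) : ℕ → Finset (List (LGraph ℓ V))
  | 0 => (Finset.univ.filter fun C : LGraph ℓ V => F.IsIsomorphic C).image fun C => [C]
  | k + 1 => (histories F k).biUnion fun h => (F.nextCopies h).image (· :: h)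

theorem IsHistory.mem_histories {h : List (LGraph ℓ V)} (hh : F.IsHistory h) :
    h ∈ F.histories (h.length - 1) := by
  classical
  induction hh with
  | single C hC => simp [histories, hC]
  | cons C h hh hC hnew ha ih =>
    have hpos : 0 < h.length := by cases hh <;> simp
    have : (C :: h).length - 1 = (h.length - 1) + 1 := by simp; omega
    rw [this, histories, Finset.mem_biUnion]
    exact ⟨h, ih, Finset.mem_image.2 ⟨C, mem_nextCopies.2 ⟨hC, hnew, ha⟩, rfl⟩⟩

theorem isHistory_of_mem_histories {k : ℕ} {h : List (LGraph ℓ V)} (hh : h ∈ F.histories k) :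
    F.IsHistory h ∧ h.length = k + 1 := by
  classical
  induction k generalizing h with
  | zero =>
    simp only [histories, Finset.mem_image, Finset.mem_filter, Finset.mem_univ, true_and] at hh
    obtain ⟨C, hC, rfl⟩ := hh
    exact ⟨IsHistory.single C hC, rfl⟩
  | succ k ih =>
    simp only [histories, Finset.mem_biUnion, Finset.mem_image] at hh
    obtain ⟨h', hh', C, hC, rfl⟩ := hh
    obtain ⟨h1, h2⟩ := ih hh'
    obtain ⟨h3, h4, h5⟩ := mem_nextCopies.1 hC
    exact ⟨IsHistory.cons C h' h1 h3 h4 h5, by simp [h2]⟩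

theorem sum_weight_le (hF : F.IsTight R M) (hM : 0 < M)
    {p z c : ℝ} {N : ℕ} (hp : 0 ≤ p) (hp1 : p ≤ 1) (hz : 1 ≤ z) (hc1 : c ≤ 1)
    (hc : 4 * ((M + 1 : ℝ) * (shapeCount (ℓ + R) * c)) ≤ 1)
    (hpz : p * z ^ (4 * R) ≤ c) (hn : (Fintype.card V : ℝ) = z ^ (4 * M))
    (hN : 2 * (shapeCount (ℓ + R) * ((ℓ + R : ℝ) * N + 1) ^ (ℓ + R)) ≤ z) (hNz : N ≤ z)
    (k : ℕ) (hk : k < N) :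
    ∑ h ∈ F.histories (V := V) k, F.weight p z h ≤
      shapeCount (ℓ + R) * (Fintype.card V : ℝ) ^ (ℓ + R) := by
  classical
  have hz0 : 0 < z := by linarith
  induction k with
  | zero =>
    rw [histories, Finset.sum_image fun a _ b _ hab => by simpa using hab]
    have hw : ∀ C ∈ Finset.univ.filter fun C : LGraph ℓ V => F.IsIsomorphic C,
        F.weight p z [C] ≤ 1 := by
      intro C _
      have hr : IsRegularStep C [] := by simp [IsRegularStep, hull]
      have hJ : F.oldestOpen ([] : List (LGraph ℓ V)) = none := by simp [oldestOpen]
      have h0 : F.weight p z ([] : List (LGraph ℓ V)) = 1 := by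
        simp [weight, hull, boundCount, degCount, freeCount]
      rw [weight_cons, h0, one_mul, stepFactor, if_pos hr, if_pos hJ]
      exact mul_le_one₀ (pow_le_one₀ hp hp1) (by positivity) (inv_le_one_of_one_le₀ hz)
    refine (Finset.sum_le_card_nsmul _ _ 1 hw).trans ?_
    rw [nsmul_eq_mul, mul_one]
    exact_mod_cast card_copies_le (V := V) hF
  | succ k ih =>
    refine le_trans ?_ (ih (by omega))
    rw [histories, Finset.sum_biUnion]
    · refine Finset.sum_le_sum fun h hh => ?_
      obtain ⟨h1, h2⟩ := isHistory_of_mem_histories hh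
      rw [Finset.sum_image fun a _ b _ hab => by simpa using hab]
      simp only [weight_cons, ← Finset.mul_sum]
      exact mul_le_of_le_one_right (weight_nonneg hp hz0.le h)
        (sum_step_le hF hM h1 hp hz hc1 hc hpz hn (by omega) hN hNz)
    · intro a _ b _ hab
      rw [Function.onFun, Finset.disjoint_left]
      intro x hx hx'
      obtain ⟨C, -, rfl⟩ := Finset.mem_image.1 hx
      obtain ⟨D, -, hD⟩ := Finset.mem_image.1 hx'
      simp only [List.cons.injEq] at hD
      exact hab hD.2.symm

open Classical in
/-- The histories of length at most `N` that have length `N` or at least `K` degenerate steps. -/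
noncomputable def badHistories (F : LGraph ℓ W) (K N : ℕ) : Finset (List (LGraph ℓ V)) :=
  ((Finset.range N).biUnion fun k => F.histories k).filter fun h =>
    h.length = N ∨ K ≤ degCount h

theorem mem_badHistories {K N : ℕ} {h : List (LGraph ℓ V)} (hh : F.IsHistory h)
    (hlen : h.length ≤ N) (hbad : h.length = N ∨ K ≤ degCount h) :
    h ∈ F.badHistories K N := by
  classical
  have hpos : 0 < h.length := by cases hh <;> simp
  refine Finset.mem_filter.2 ⟨Finset.mem_biUnion.2 ⟨h.length - 1, ?_, hh.mem_histories⟩, hbad⟩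
  rw [Finset.mem_range]; omega

/-- The expected number of bad histories in the random hypergraph tends to zero. -/
theorem sum_badHistories_le (hF : F.IsTight R M)
    (hR : 0 < R) (hM : 2 ≤ M) (hlt : F.gamma + 1 < ℓ → 3 ≤ M) (heq : F.gamma + 1 = ℓ → R ≤ M)
    {p z c : ℝ} {N : ℕ} (hp : 0 ≤ p) (hp1 : p ≤ 1) (hz : 1 ≤ z) (hc1 : c ≤ 1)
    (hc : 4 * ((M + 1 : ℝ) * (shapeCount (ℓ + R) * c)) ≤ 1)
    (hpz : p * z ^ (4 * R) ≤ c) (hn : (Fintype.card V : ℝ) = z ^ (4 * M))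
    (hN : 2 * (shapeCount (ℓ + R) * ((ℓ + R : ℝ) * N + 1) ^ (ℓ + R)) ≤ z) (hNz : N ≤ z)
    {T : ℕ} (hT : T = 4 * M * (ℓ + R) + 2)
    (hN2 : z ^ (T + 2) ≤ 2 ^ (N - (2 * (T + 2) + 2))) :
    ∑ h ∈ F.badHistories (V := V) (T + 2) N, p ^ (hull h).edges.card ≤
      shapeCount (ℓ + R) * z⁻¹ := by
  classical
  have hz0 : 0 < z := by linarith
  have h1 : ∀ h ∈ F.badHistories (V := V) (T + 2) N,
      p ^ (hull h).edges.card ≤ z⁻¹ ^ T * F.weight p z h := by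
    intro h hh
    obtain ⟨hh, hbad⟩ := Finset.mem_filter.1 hh
    obtain ⟨k, -, hk⟩ := Finset.mem_biUnion.1 hh
    have := (isHistory_of_mem_histories hk).1.pow_mul_le_weight hF hR hM hlt heq hp hz hN2 hbad
    rw [inv_pow, inv_mul_eq_div, le_div_iff₀ (by positivity)]
    exact this
  have h2 : ∑ h ∈ F.badHistories (V := V) (T + 2) N, F.weight p z h ≤
      ∑ k ∈ Finset.range N, ∑ h ∈ F.histories (V := V) k, F.weight p z h := by
    refine (Finset.sum_le_sum_of_subset_of_nonneg (Finset.filter_subset _ _)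
      fun h _ _ => weight_nonneg hp hz0.le h).trans ?_
    rw [Finset.sum_biUnion]
    intro a _ b _ hab
    rw [Function.onFun, Finset.disjoint_left]
    intro h ha hb
    have e1 := (isHistory_of_mem_histories ha).2
    have e2 := (isHistory_of_mem_histories hb).2
    omega
  have h3 : ∑ k ∈ Finset.range N, ∑ h ∈ F.histories (V := V) k, F.weight p z h ≤
      N * (shapeCount (ℓ + R) * (Fintype.card V : ℝ) ^ (ℓ + R)) := by
    have := Finset.sum_le_card_nsmul (Finset.range N)
      (fun k => ∑ h ∈ F.histories (V := V) k, F.weight p z h) _ fun k hk =>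
      sum_weight_le hF (by omega) hp hp1 hz hc1 hc hpz hn hN hNz k (Finset.mem_range.1 hk)
    rwa [Finset.card_range, nsmul_eq_mul] at this
  calc ∑ h ∈ F.badHistories (V := V) (T + 2) N, p ^ (hull h).edges.card
      ≤ z⁻¹ ^ T * ∑ h ∈ F.badHistories (V := V) (T + 2) N, F.weight p z h := by
        rw [Finset.mul_sum]; exact Finset.sum_le_sum h1
    _ ≤ z⁻¹ ^ T * (z * (shapeCount (ℓ + R) * (Fintype.card V : ℝ) ^ (ℓ + R))) := by
        gcongr
        exact h2.trans (h3.trans (by gcongr))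
    _ = shapeCount (ℓ + R) * z⁻¹ := by
        rw [hn, hT, ← pow_mul, pow_add, inv_pow]
        field_simp

end Weight


/-! ### The union bound in the random hypergraph -/

section Probability

open ProbabilityTheory MeasureTheory unitInterval

theorem setBernoulli_superset_le {ι : Type*} (u : Set ι) (p : I) (S : Finset ι) :
    (setBernoulli u p).real {E | (S : Set ι) ⊆ E} ≤ (p : ℝ) ^ S.card := by
  have h1 : setBernoulli u p {E | (S : Set ι) ⊆ E} ≤ (toNNReal p : ENNReal) ^ S.card := by
    rw [setBernoulli_apply']
    have : ((fun q : ι → Prop => {i | q i}) ⁻¹' {E | (S : Set ι) ⊆ E}) =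
        Set.pi S fun _ => {True} := by
      ext q
      simp [Set.pi, Set.subset_def]
    rw [this, Measure.infinitePi_pi _ (fun _ _ => MeasurableSet.of_discrete), ← Finset.prod_const]
    refine Finset.prod_le_prod' fun i _ => ?_
    by_cases hi : i ∈ u <;> simp [hi]
  rw [measureReal_def]
  refine (ENNReal.toReal_mono (by finiteness) h1).trans ?_
  simp

theorem edges_ofEdges_subset (ℓ n : ℕ) (E : Set (Finset (Fin n))) :
    ((ofEdges ℓ n E).edges : Set (Finset (Fin n))) ⊆ E := fun e he => by
  classical exact (Finset.mem_filter.1 he).2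

/-- The union bound: if the failure of `P` forces one of the sets `X i` into the edge set, then `P`
holds with probability at least `1 - ∑ p ^ |X i|`. -/
theorem one_sub_sum_le_binomialProb (ℓ n : ℕ) (p : I) (P : LGraph ℓ (Fin n) → Prop)
    {ι : Type*} (S : Finset ι) (X : ι → Finset (Finset (Fin n)))
    (h : ∀ G, ¬ P G → ∃ i ∈ S, X i ⊆ G.edges) :
    1 - ∑ i ∈ S, (p : ℝ) ^ (X i).card ≤ binomialProb ℓ n p P := by
  unfold binomialProb
  set μ := setBernoulli {e : Finset (Fin n) | e.card = ℓ} p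
  have hmeas : MeasurableSet {E : Set (Finset (Fin n)) | P (ofEdges ℓ n E)} :=
    (Set.toFinite _).measurableSet
  have hc : μ.real {E : Set (Finset (Fin n)) | P (ofEdges ℓ n E)}ᶜ ≤
      ∑ i ∈ S, (p : ℝ) ^ (X i).card := by
    calc μ.real {E : Set (Finset (Fin n)) | P (ofEdges ℓ n E)}ᶜ
        ≤ μ.real (⋃ i ∈ S, {E | (X i : Set (Finset (Fin n))) ⊆ E}) := by
          refine measureReal_mono (fun E hE => ?_) (measure_ne_top μ _)
          obtain ⟨i, hi, hX⟩ := h _ hE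
          exact Set.mem_biUnion hi
            ((Finset.coe_subset.2 hX).trans (edges_ofEdges_subset ℓ n E))
      _ ≤ ∑ i ∈ S, μ.real {E | (X i : Set (Finset (Fin n))) ⊆ E} :=
          measureReal_biUnion_finset_le _ _
      _ ≤ _ := Finset.sum_le_sum fun i _ => setBernoulli_superset_le _ p (X i)
  rw [probReal_compl_eq_one_sub hmeas] at hc
  linarith

theorem binomialProb_le_one (ℓ n : ℕ) (p : I) (P : LGraph ℓ (Fin n) → Prop) :
    binomialProb ℓ n p P ≤ 1 := measureReal_le_one

end Probability

/-! ### Asymptotic estimates and the conclusion -/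

section Asymptotics

/-- A power of a logarithm, written in the form needed for the length `N` of the exploration, is
eventually below `z`. -/
theorem eventually_polylog_le (C : ℝ) (hC : 0 < C) (v a b : ℕ) :
    ∀ᶠ z : ℝ in atTop, 2 * (C * ((v : ℝ) * ((a + b * ⌈2 * Real.log z⌉₊ : ℕ) : ℝ) + 1) ^ v) ≤ z := by
  set D : ℝ := v * (a + b * 3) + 1
  have hD : 0 < D := by positivity
  have ho := (Real.isLittleO_pow_log_id_atTop (n := v)).bound
    (show 0 < (2 * (C * D ^ v))⁻¹ by positivity)
  filter_upwards [ho, eventually_ge_atTop (Real.exp 1)] with z hz hze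
  have hz0 : 0 < z := (Real.exp_pos 1).trans_le hze
  have hlog : 1 ≤ Real.log z := (Real.le_log_iff_exp_le hz0).2 hze
  have hceil : (⌈2 * Real.log z⌉₊ : ℝ) ≤ 3 * Real.log z := by
    have := Nat.ceil_lt_add_one (show 0 ≤ 2 * Real.log z by positivity)
    linarith
  have hin : (v : ℝ) * ((a + b * ⌈2 * Real.log z⌉₊ : ℕ) : ℝ) + 1 ≤ D * Real.log z := by
    push_cast
    have h1 : (a : ℝ) + b * ⌈2 * Real.log z⌉₊ ≤ (a + b * 3) * Real.log z := by
      have := mul_le_mul_of_nonneg_left hceil (Nat.cast_nonneg (α := ℝ) b)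
      have := mul_le_mul_of_nonneg_left hlog (Nat.cast_nonneg (α := ℝ) a)
      linarith
    have := mul_le_mul_of_nonneg_left h1 (Nat.cast_nonneg (α := ℝ) v)
    simp only [D]
    linarith
  rw [Real.norm_of_nonneg (by positivity), id, Real.norm_of_nonneg hz0.le,
    inv_mul_eq_div, le_div_iff₀ (by positivity)] at hz
  calc 2 * (C * ((v : ℝ) * ((a + b * ⌈2 * Real.log z⌉₊ : ℕ) : ℝ) + 1) ^ v)
      ≤ 2 * (C * (D * Real.log z) ^ v) := by gcongr
    _ = Real.log z ^ v * (2 * (C * D ^ v)) := by rw [mul_pow]; ring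
    _ ≤ z := hz

theorem pow_le_two_pow {z : ℝ} (hz : 1 ≤ z) (T : ℕ) :
    z ^ T ≤ 2 ^ (T * ⌈2 * Real.log z⌉₊) := by
  have hz0 : 0 < z := by linarith
  rw [mul_comm, pow_mul]
  refine pow_le_pow_left₀ hz0.le ?_ T
  rw [← Real.log_le_log_iff hz0 (by positivity), Real.log_pow]
  have h1 := Nat.le_ceil (2 * Real.log z)
  have h2 : 1 / 2 < Real.log 2 := by have := Real.log_two_gt_d9; linarith
  have h3 := Real.log_nonneg hz
  nlinarith

end Asymptotics

end LGraph

theorem theorem2p5 (ℓ : ℕ) (hℓ : 2 ≤ ℓ) {W : Type*} (F : LGraph ℓ W)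
    (hbal : F.IsStrictlyBalanced)
    (hF : (F.edges.card = 3 ∧ F.gamma = ℓ - 1) ∨ 4 ≤ F.edges.card) :
    ∃ c : ℝ, 0 < c ∧ ∃ L : ℕ, 0 < L ∧
      ∀ p : ℕ → unitInterval,
        (∀ᶠ n : ℕ in atTop, (p n : ℝ) ≤ c * (n : ℝ) ^ (-1 / F.maxDensity)) →
        Tendsto
          (fun n : ℕ => LGraph.binomialProb ℓ n (p n) fun G =>
            ∀ B : LGraph ℓ (Fin n), B.IsSubgraph G → F.IsBlock B → B.verts.card ≤ L)
          atTop (𝓝 1) := by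
  obtain ⟨R, hv⟩ : ∃ R, F.verts.card = ℓ + R := ⟨F.verts.card - ℓ, by have := hbal.1; omega⟩
  obtain ⟨M, he⟩ : ∃ M, F.edges.card = M + 1 := ⟨F.edges.card - 1, by omega⟩
  have hR : 0 < R := by have := hbal.1; omega
  have hM : 2 ≤ M := by omega
  have hT : F.IsTight R M := hbal.isTight hv he
  have hlt : F.gamma + 1 < ℓ → 3 ≤ M := by omega
  have heq : F.gamma + 1 = ℓ → R ≤ M := by
    classical exact hT.le_of_gamma (by omega)
  have hm : F.maxDensity = (M : ℝ) / R := by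
    rw [hbal.2.1, LGraph.density, hv, he]
    push_cast
    congr 1 <;> ring
  -- `c` makes the regular steps at an open member contribute at most `1 / 2`, even after the factor
  -- `2` of `stepFactor`; `T` gives bad histories the weight `n ^ v(F) * z ^ 2`, where `n ^ v(F)`
  -- pays for the first copy and `z ^ 2` for the `N ≤ z` lengths.
  set S : ℝ := ((LGraph.shapeCount (ℓ + R) : ℕ) : ℝ) with hS
  have hS1 : 1 ≤ S := Nat.one_le_cast.2 (LGraph.shapeCount_pos _)
  set c : ℝ := (4 * ((M + 1) * S))⁻¹ with hc
  have hden : 1 ≤ 4 * ((M + 1 : ℝ) * S) := by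
    have : (0 : ℝ) ≤ M := Nat.cast_nonneg _
    nlinarith
  have hc0 : 0 < c := by positivity
  have hc1 : c ≤ 1 := inv_le_one_of_one_le₀ hden
  have hcS : 4 * ((M + 1 : ℝ) * (S * c)) ≤ 1 := by
    have : 4 * ((M + 1 : ℝ) * (S * c)) = (4 * ((M + 1) * S)) * c := by ring
    rw [this, hc, mul_inv_cancel₀ (by positivity)]
  set T := 4 * M * (ℓ + R) + 2 with hTdef
  refine ⟨c, hc0, (ℓ + R) * (1 + (2 * (ℓ + R) + 2) * (T + 2)), by positivity, fun p hp => ?_⟩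
  set z : ℕ → ℝ := fun n => (n : ℝ) ^ (1 / (4 * M : ℝ)) with hz
  have hMpos : (0 : ℝ) < M := by exact_mod_cast (show 0 < M by omega)
  have hRpos : (0 : ℝ) < R := by exact_mod_cast hR
  have hzlim : Tendsto z atTop atTop :=
    (tendsto_rpow_atTop (by positivity)).comp tendsto_natCast_atTop_atTop
  have hlow : Tendsto (fun n => 1 - S * (z n)⁻¹) atTop (𝓝 1) := by
    have := (tendsto_inv_atTop_zero.comp hzlim).const_mul S
    simpa using this.const_sub 1
  refine tendsto_of_tendsto_of_tendsto_of_le_of_le' hlow tendsto_const_nhds ?_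
    (Eventually.of_forall fun n => LGraph.binomialProb_le_one _ _ _ _)
  filter_upwards [hp, hzlim.eventually (LGraph.eventually_polylog_le S (by positivity) (ℓ + R)
    (2 * (T + 2) + 2) (T + 2)), hzlim.eventually_ge_atTop 1, eventually_ge_atTop 1]
    with n hpn hN hz1 hn1
  set N := (2 * (T + 2) + 2) + (T + 2) * ⌈2 * Real.log (z n)⌉₊ with hNdef
  have hn0 : (0 : ℝ) < n := by exact_mod_cast hn1
  have hzn : (Fintype.card (Fin n) : ℝ) = z n ^ (4 * M) := by
    rw [Fintype.card_fin, hz, ← Real.rpow_natCast, ← Real.rpow_mul hn0.le]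
    push_cast
    rw [one_div_mul_cancel (by positivity), Real.rpow_one]
  have hpz : (p n : ℝ) * z n ^ (4 * R) ≤ c := by
    have e1 : z n ^ (4 * R) = (n : ℝ) ^ ((R : ℝ) / M) := by
      rw [hz, ← Real.rpow_natCast, ← Real.rpow_mul hn0.le]
      congr 1
      push_cast
      field_simp
    have e2 : (n : ℝ) ^ (-1 / F.maxDensity) * (n : ℝ) ^ ((R : ℝ) / M) = 1 := by
      rw [← Real.rpow_add hn0, hm]
      have : -1 / ((M : ℝ) / R) + (R : ℝ) / M = 0 := by field_simp; ring
      rw [this, Real.rpow_zero]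
    calc (p n : ℝ) * z n ^ (4 * R)
        ≤ c * (n : ℝ) ^ (-1 / F.maxDensity) * (n : ℝ) ^ ((R : ℝ) / M) := by
          rw [e1]; gcongr
      _ = c := by rw [mul_assoc, e2, mul_one]
  have hN' : 2 * (S * ((ℓ + R : ℝ) * N + 1) ^ (ℓ + R)) ≤ z n := by exact_mod_cast hN
  have hNz : (N : ℝ) ≤ z n := by
    refine le_trans ?_ hN'
    have hb : (1 : ℝ) ≤ (ℓ + R : ℝ) * N + 1 := by
      have : (0 : ℝ) ≤ (ℓ + R : ℝ) * N := by positivity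
      linarith
    have h1 : (ℓ + R : ℝ) * N + 1 ≤ ((ℓ + R : ℝ) * N + 1) ^ (ℓ + R) :=
      le_self_pow₀ hb (by omega)
    have h2 : (1 : ℝ) ≤ ℓ + R := by exact_mod_cast (show 1 ≤ ℓ + R by omega)
    have h3 : (N : ℝ) ≤ (ℓ + R : ℝ) * N := le_mul_of_one_le_left (by positivity) h2
    nlinarith
  have hN2 : z n ^ (T + 2) ≤ 2 ^ (N - (2 * (T + 2) + 2)) := by
    rw [hNdef, Nat.add_sub_cancel_left]
    exact LGraph.pow_le_two_pow hz1 (T + 2)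
  refine le_trans ?_ (LGraph.one_sub_sum_le_binomialProb ℓ n (p n) _
    (F.badHistories (T + 2) N) (fun h => (LGraph.hull h).edges) ?_)
  · have := LGraph.sum_badHistories_le (V := Fin n) hT hR hM hlt heq (p n).2.1 (p n).2.2 hz1 hc1
      hcS hpz hzn hN' hNz hTdef hN2
    linarith
  · intro G hG
    push Not at hG
    obtain ⟨B, hBG, hB, hBL⟩ := hG
    rcases hB.card_verts_le_or hT hR hM hlt heq (T + 2) N (by omega) with h | ⟨h, hh, hhB, h1, h2⟩
    · omega
    · exact ⟨h, LGraph.mem_badHistories hh h1 h2, hhB.trans hBG.2⟩
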